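/- Let $(P,g_P)$ be a Riemannian manifold and $(Q,g_Q,J)$ a Kähler manifold (an almost Hermitian manifold, $J^2=-1$ and $g_Q(JX,JY)=g_Q(X,Y)$, whose $J$ is parallel for the Levi-Civita connection $\nabla^Q$). Let $\pi:P\to Q$ be a smooth Riemannian map, i.e. $g_Q(\pi_*X,\pi_*Y)=g_P(X,Y)$ for $X,Y\in(\ker\pi_*)^\perp$. Assume that $\pi$ is slant with slant angle $\theta$: for every point of $P$ and every nonzero $X\in(\ker\pi_*)^\perp$ the angle between $J\pi_*X$ and the space $\mathrm{range}\,\pi_*$ equals the constant $\theta$. Assume also that $\pi$ is Clairaut with $s=e^f$ for a smooth function $f:Q\to\mathbb R$: around each point of $P$, $\mathrm{range}\,\pi_*$ is the restriction along $\pi$ of a smooth distribution $D$ on an open set $V\subseteq Q$ such that for every geodesic $\eta$ of $Q$ in $V$ the function $s(\eta(t))\sin\omega(t)$ is constant, where $\omega(t)$ is the angle between $\dot\eta(t)$ and its component in $D^\perp$ ($\omega(t)=\pi/2$ if this component is zero). For a vector $w\in T_{\pi(p)}Q$ tangent to $\mathrm{range}\,\pi_{*p}$ write $Jw=\alpha w+\delta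 w$, and for $u\in(\mathrm{range}\,\pi_{*p})^\perp$ write $Ju=Bu+Cu$, with $\alpha w,Bu\in\mathrm{range}\,\pi_{*p}$ and $\delta w,Cu\in(\mathrm{range}\,\pi_{*p})^\perp$. Let $\nabla^{\pi\perp}_XV$ be the $(\mathrm{range}\,\pi_*)^\perp$-component of the pullback connection $\nabla^{\pi}_XV$, and $(\nabla\pi_*)(X,Y)=\nabla^{\pi}_X\pi_*Y-\pi_*(\nabla^P_XY)$. The map $\pi$ is totally geodesic if $\nabla\pi_*=0$, and a distribution $\mathcal D$ on $P$ is totally geodesic if $\nabla^P_XY\in\Gamma(\mathcal D)$ for all $X,Y\in\Gamma(\mathcal D)$. Consider the conditions (i) $\ker\pi_*$ is totally geodesic; (ii) $(\ker\pi_*)^\perp$ is totally geodesic; (iii) for all $X,Y\in\Gamma((\ker\pi_*)^\perp)$, $$\cos^2\theta\,\pi_*(\nabla^P_XY)-\nabla^{\pi\perp}_X\delta(\alpha\pi_*Y)-B\nabla^{\pi\perp}_X\delta\pi_*Y-C\nabla^{\pi\perp}_X\delta\pi_*Y-\pi_*(\nabla^P_XY)=0.$$ If $\pi$ is totally geodesic,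 then (i), (ii) and (iii) hold. Conversely, if (i), (ii) and (iii) hold and the rank of $\pi$ is different from $1$ at every point, then $\pi$ is totally geodesic. In particular, when $\pi$ has rank $1$ at no point, $\pi$ is totally geodesic if and only if (i), (ii) and (iii) hold. -/

import Mathlib

open Bundle
open scoped Manifold ContDiff Topology

noncomputable section

namespace SlantMaps

section Connection

variable (E : Type*) [NormedAddCommGroup E] [NormedSpace ℝ E] [FiniteDimensional ℝ E]
  {M : Type*} [TopologicalSpace M] [ChartedSpace E M] [IsManifold 𝓘(ℝ, E) ∞ M]

instance instFiniteDimensionalTangentSpace (x : M) :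
    FiniteDimensional ℝ (TangentSpace 𝓘(ℝ, E) x) :=
  inferInstanceAs (FiniteDimensional ℝ E)

variable {E}

/-- Components, in the chart centred at `c`, of a tangent vector at `x`. -/
def toCoord (c x : M) : TangentSpace 𝓘(ℝ, E) x →L[ℝ] E :=
  (trivializationAt E (fun x : M => TangentSpace 𝓘(ℝ, E) x) c).continuousLinearMapAt ℝ x

/-- The tangent vector at `x` with given components in the chart centred at `c`. -/
def ofCoord (c x : M) : E →L[ℝ] TangentSpace 𝓘(ℝ, E) x :=
  (trivializationAt E (fun x : M => TangentSpace 𝓘(ℝ, E) x) c).symmL ℝ x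

variable [h : RiemannianBundle (fun x : M => TangentSpace 𝓘(ℝ, E) x)]

/-- The metric tensor read in the chart centred at `c`: the matrix `g_ij (y)` as a bilinear form
on the model space. -/
def metricCoord (c : M) (y : E) : E →L[ℝ] E →L[ℝ] ℝ :=
  (h.g.inner ((extChartAt 𝓘(ℝ, E) c).symm y)).bilinearComp
    (ofCoord c ((extChartAt 𝓘(ℝ, E) c).symm y)) (ofCoord c ((extChartAt 𝓘(ℝ, E) c).symm y))

/-- Christoffel symbols in the chart centred at `c`: `Γ(u, v)` is the vector `z` with
`g(z, w) = (∂_u g(v, w) + ∂_v g(u, w) - ∂_w g(u, v)) / 2` for every `w`. -/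
def christoffel (c : M) (y u v : E) : E :=
  (metricCoord c y).inverse
    ((1 / 2 : ℝ) • (fderiv ℝ (metricCoord c) y u v + fderiv ℝ (metricCoord c) y v u
      - ((fderiv ℝ (metricCoord c) y).flip u).flip v))

section Along

variable {E' : Type*} [NormedAddCommGroup E'] [NormedSpace ℝ E']
  {N : Type*} [TopologicalSpace N] [ChartedSpace E' N]

/-- The Levi-Civita covariant derivative of a vector field `V` along a map `F : N → M`, at `x` and in
the direction `ξ`, computed in the chart of `M` centred at `c` (where `F x` lies in the domain of
this chart): its components are `ξ(Vᵏ) + Γᵏ(dF ξ, V)`. -/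
def covAlongIn (c : M) (F : N → M) (V : ∀ x : N, TangentSpace 𝓘(ℝ, E) (F x)) (x : N)
    (ξ : TangentSpace 𝓘(ℝ, E') x) : TangentSpace 𝓘(ℝ, E) (F x) :=
  ofCoord c (F x)
    (mvfderiv 𝓘(ℝ, E') (fun x' : N => toCoord c (F x') (V x')) x ξ
      + christoffel c (extChartAt 𝓘(ℝ, E) c (F x))
          (toCoord c (F x) (mfderiv 𝓘(ℝ, E') 𝓘(ℝ, E) F x ξ)) (toCoord c (F x) (V x)))

/-- The pullback along `F : N → M` of the Levi-Civita connection of `M`. -/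
def covAlong (F : N → M) (V : ∀ x : N, TangentSpace 𝓘(ℝ, E) (F x)) (x : N)
    (ξ : TangentSpace 𝓘(ℝ, E') x) : TangentSpace 𝓘(ℝ, E) (F x) :=
  covAlongIn (F x) F V x ξ

end Along

/-- The Levi-Civita connection: `leviCivita Y x ξ` is `∇_ξ Y` at `x`. -/
def leviCivita (Y : ∀ x : M, TangentSpace 𝓘(ℝ, E) x) (x : M) (ξ : TangentSpace 𝓘(ℝ, E) x) :
    TangentSpace 𝓘(ℝ, E) x :=
  covAlong (fun x' : M => x') Y x ξ

variable (E) in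
/-- The velocity of a curve. -/
def velocity (η : ℝ → M) (t : ℝ) : TangentSpace 𝓘(ℝ, E) (η t) :=
  mfderiv 𝓘(ℝ, ℝ) 𝓘(ℝ, E) η t (1 : ℝ)

variable (E) in
/-- `η` is a geodesic on the set `s` of times: it is smooth there and its acceleration `∇_η' η'`,
which can be computed in any chart around `η t`, vanishes. -/
def IsGeodesicOn (η : ℝ → M) (s : Set ℝ) : Prop :=
  ContMDiffOn 𝓘(ℝ, ℝ) 𝓘(ℝ, E) ∞ η s ∧
    ∀ t ∈ s, ∃ c : M, η t ∈ (extChartAt 𝓘(ℝ, E) c).source ∧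
      covAlongIn (E' := ℝ) c η (velocity E η) t (1 : ℝ) = 0

/-- The vector field `Y` is smooth on `s`. -/
def IsSmoothFieldOn (Y : ∀ x : M, TangentSpace 𝓘(ℝ, E) x) (s : Set M) : Prop :=
  ContMDiffOn 𝓘(ℝ, E) 𝓘(ℝ, E).tangent ∞ (fun x => (⟨x, Y x⟩ : TangentBundle 𝓘(ℝ, E) M)) s

/-- `Y` is a smooth section of the distribution `D`. -/
def IsSectionOf (D : ∀ x : M, Submodule ℝ (TangentSpace 𝓘(ℝ, E) x))
    (Y : ∀ x : M, TangentSpace 𝓘(ℝ, E) x) : Prop :=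
  IsSmoothFieldOn Y Set.univ ∧ ∀ x, Y x ∈ D x

/-- A distribution `D` is totally geodesic: `∇_X Y ∈ Γ(D)` for all `X, Y ∈ Γ(D)`. -/
def IsTotallyGeodesicDistribution
    (D : ∀ x : M, Submodule ℝ (TangentSpace 𝓘(ℝ, E) x)) : Prop :=
  ∀ X Y : ∀ x : M, TangentSpace 𝓘(ℝ, E) x, IsSectionOf D X → IsSectionOf D Y →
    ∀ x, leviCivita Y x (X x) ∈ D x

/-- `D` is a smooth distribution (a smooth subbundle of the tangent bundle) on the open set `s`:
orthogonal projection onto `D` sends smooth vector fields to smooth vector fields. -/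
def IsSmoothDistributionOn (D : ∀ x : M, Submodule ℝ (TangentSpace 𝓘(ℝ, E) x))
    (s : Set M) : Prop :=
  ∀ Z : ∀ x : M, TangentSpace 𝓘(ℝ, E) x, IsSmoothFieldOn Z s →
    IsSmoothFieldOn (fun x => (D x).starProjection (Z x)) s

/-- `J` is a Kähler structure on the Riemannian manifold `M`: a smooth tensor of type `(1, 1)` with
`J² = -1`, orthogonal for the metric, and parallel for the Levi-Civita connection. -/
structure IsKahler (J : ∀ x : M, TangentSpace 𝓘(ℝ, E) x →L[ℝ] TangentSpace 𝓘(ℝ, E) x) :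
    Prop where
  smooth : ContMDiff 𝓘(ℝ, E) (𝓘(ℝ, E).prod 𝓘(ℝ, E →L[ℝ] E)) ∞
    (fun x => TotalSpace.mk' (E →L[ℝ] E)
      (E := fun x : M => TangentSpace 𝓘(ℝ, E) x →L[ℝ] TangentSpace 𝓘(ℝ, E) x) x (J x))
  sq : ∀ (x : M) (v : TangentSpace 𝓘(ℝ, E) x), J x (J x v) = -v
  orthogonal : ∀ (x : M) (v w : TangentSpace 𝓘(ℝ, E) x),
    inner ℝ (J x v) (J x w) = inner ℝ v w
  parallel : ∀ Y : ∀ x : M, TangentSpace 𝓘(ℝ, E) x, IsSmoothFieldOn Y Set.univ →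
    ∀ (x : M) (ξ : TangentSpace 𝓘(ℝ, E) x),
      leviCivita (fun x' => J x' (Y x')) x ξ = J x (leviCivita Y x ξ)

end Connection

section Maps

variable (E : Type*) [NormedAddCommGroup E] [NormedSpace ℝ E] [FiniteDimensional ℝ E]
  {P : Type*} [TopologicalSpace P] [ChartedSpace E P] [IsManifold 𝓘(ℝ, E) ∞ P]
  (E' : Type*) [NormedAddCommGroup E'] [NormedSpace ℝ E'] [FiniteDimensional ℝ E']
  {Q : Type*} [TopologicalSpace Q] [ChartedSpace E' Q] [IsManifold 𝓘(ℝ, E') ∞ Q]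

/-- The differential `Φ_*` at `p`. -/
def push (Φ : P → Q) (p : P) :
    TangentSpace 𝓘(ℝ, E) p →L[ℝ] TangentSpace 𝓘(ℝ, E') (Φ p) :=
  mfderiv 𝓘(ℝ, E) 𝓘(ℝ, E') Φ p

/-- `ker Φ_*` at `p`. -/
def kerDist (Φ : P → Q) (p : P) : Submodule ℝ (TangentSpace 𝓘(ℝ, E) p) :=
  (push E E' Φ p).ker

/-- `range Φ_*` at `p`. -/
def rangeDist (Φ : P → Q) (p : P) : Submodule ℝ (TangentSpace 𝓘(ℝ, E') (Φ p)) :=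
  (push E E' Φ p).range

variable [RiemannianBundle (fun x : P => TangentSpace 𝓘(ℝ, E) x)]

/-- `(ker Φ_*)^⊥` at `p`. -/
def horDist (Φ : P → Q) (p : P) : Submodule ℝ (TangentSpace 𝓘(ℝ, E) p) :=
  (kerDist E E' Φ p)ᗮ

variable [RiemannianBundle (fun x : Q => TangentSpace 𝓘(ℝ, E') x)]

/-- `Φ` is a Riemannian map: it is smooth, and `Φ_*` is isometric on `(ker Φ_*)^⊥`. -/
def IsRiemannianMap (Φ : P → Q) : Prop :=
  ContMDiff 𝓘(ℝ, E) 𝓘(ℝ, E') ∞ Φ ∧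
    ∀ p, ∀ X ∈ horDist E E' Φ p, ∀ Y ∈ horDist E E' Φ p,
      inner ℝ (push E E' Φ p X) (push E E' Φ p Y) = inner ℝ X Y

/-- The second fundamental form `(∇Φ_*)(X, Y) = ∇^Φ_X (Φ_* Y) - Φ_* (∇_X Y)` of a map `Φ`. -/
def secondFundamentalForm (Φ : P → Q) (X Y : ∀ p : P, TangentSpace 𝓘(ℝ, E) p) (p : P) :
    TangentSpace 𝓘(ℝ, E') (Φ p) :=
  covAlong Φ (fun p' => push E E' Φ p' (Y p')) p (X p) - push E E' Φ p (leviCivita Y p (X p))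

/-- `Φ` is totally geodesic: `∇Φ_* = 0`. -/
def IsTotallyGeodesicMap (Φ : P → Q) : Prop :=
  ∀ X Y : ∀ p : P, TangentSpace 𝓘(ℝ, E) p,
    IsSmoothFieldOn X Set.univ → IsSmoothFieldOn Y Set.univ →
      ∀ p, secondFundamentalForm E E' Φ X Y p = 0

section Operators

variable {E'}

/-- Component of `w` in `range Φ_*`. -/
def tangentPart (Φ : P → Q) (p : P) (w : TangentSpace 𝓘(ℝ, E') (Φ p)) :
    TangentSpace 𝓘(ℝ, E') (Φ p) :=
  (rangeDist E E' Φ p).starProjection w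

/-- Component of `w` in `(range Φ_*)^⊥`. -/
def normalPart (Φ : P → Q) (p : P) (w : TangentSpace 𝓘(ℝ, E') (Φ p)) :
    TangentSpace 𝓘(ℝ, E') (Φ p) :=
  (rangeDist E E' Φ p)ᗮ.starProjection w

/-- `∇^{Φ⊥}_ξ V`: the `(range Φ_*)^⊥`-component of the pullback covariant derivative of `V`. -/
def normalCov (Φ : P → Q) (V : ∀ p : P, TangentSpace 𝓘(ℝ, E') (Φ p)) (p : P)
    (ξ : TangentSpace 𝓘(ℝ, E) p) : TangentSpace 𝓘(ℝ, E') (Φ p) :=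
  normalPart E Φ p (covAlong Φ V p ξ)

variable (Φ : P → Q) (J : ∀ q : Q, TangentSpace 𝓘(ℝ, E') q →L[ℝ] TangentSpace 𝓘(ℝ, E') q)

/-- For `w ∈ range Φ_*`, `J w = α w + δ w` with `α w ∈ range Φ_*`. -/
def opAlpha (p : P) (w : TangentSpace 𝓘(ℝ, E') (Φ p)) : TangentSpace 𝓘(ℝ, E') (Φ p) :=
  tangentPart E Φ p (J (Φ p) w)

/-- For `w ∈ range Φ_*`, `J w = α w + δ w` with `δ w ∈ (range Φ_*)^⊥`. -/
def opDelta (p : P) (w : TangentSpace 𝓘(ℝ, E') (Φ p)) : TangentSpace 𝓘(ℝ, E') (Φ p) :=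
  normalPart E Φ p (J (Φ p) w)

/-- For `u ∈ (range Φ_*)^⊥`, `J u = B u + C u` with `B u ∈ range Φ_*`. -/
def opB (p : P) (u : TangentSpace 𝓘(ℝ, E') (Φ p)) : TangentSpace 𝓘(ℝ, E') (Φ p) :=
  tangentPart E Φ p (J (Φ p) u)

/-- For `u ∈ (range Φ_*)^⊥`, `J u = B u + C u` with `C u ∈ (range Φ_*)^⊥`. -/
def opC (p : P) (u : TangentSpace 𝓘(ℝ, E') (Φ p)) : TangentSpace 𝓘(ℝ, E') (Φ p) :=
  normalPart E Φ p (J (Φ p) u)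

/-- The identity
`cos² θ Φ_*(∇_X Y) - ∇^{Φ⊥}_X δ(α Φ_* Y) - B ∇^{Φ⊥}_X δ Φ_* Y - C ∇^{Φ⊥}_X δ Φ_* Y - Φ_*(∇_X Y) = 0`
for all `X, Y ∈ Γ((ker Φ_*)^⊥)`. -/
def SlantIdentity (θ : ℝ) : Prop :=
  ∀ X Y : ∀ p : P, TangentSpace 𝓘(ℝ, E) p,
    IsSectionOf (horDist E E' Φ) X → IsSectionOf (horDist E E' Φ) Y → ∀ p : P,
      Real.cos θ ^ 2 • push E E' Φ p (leviCivita Y p (X p))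
        - normalCov E Φ (fun x => opDelta E Φ J x (opAlpha E Φ J x (push E E' Φ x (Y x)))) p (X p)
        - opB E Φ J p (normalCov E Φ (fun x => opDelta E Φ J x (push E E' Φ x (Y x))) p (X p))
        - opC E Φ J p (normalCov E Φ (fun x => opDelta E Φ J x (push E E' Φ x (Y x))) p (X p))
        - push E E' Φ p (leviCivita Y p (X p)) = 0

/-- `Φ` is slant with slant angle `θ`: for every point `p` and every nonzero `X ∈ (ker Φ_*)^⊥`, the
angle between `J Φ_* X` and the space `range Φ_*`, that is between `J Φ_* X` and its orthogonal
projection to this space, is `θ`. (The angle with a zero projection is a right angle.) -/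
def IsSlant (θ : ℝ) : Prop :=
  ∀ p, ∀ X ∈ horDist E E' Φ p, X ≠ 0 →
    InnerProductGeometry.angle (J (Φ p) (push E E' Φ p X))
      (tangentPart E Φ p (J (Φ p) (push E E' Φ p X))) = θ

end Operators

/-- `Φ` is Clairaut with the positive function `s` on `Q`. For a geodesic `η` of `Q`, the splitting
`η' = Φ_* X + U` into a part in `range Φ_*` and a part in `(range Φ_*)^⊥` has a meaning off the image
of `Φ` only if `range Φ_*` is a distribution on `Q`; so the definition asks, around every point of
`P`, for a smooth distribution `D` on an open set of `Q` that is `range Φ_*` along `Φ`, such that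
`s (η t) * sin (ω t)` is constant for every geodesic `η` in this open set, `ω t` being the angle
between `η' t` and its component in `D^⊥` (a right angle if this component vanishes). -/
def IsClairaut (Φ : P → Q) (s : Q → ℝ) : Prop :=
  (∀ q, 0 < s q) ∧
    ∀ p₀ : P, ∃ W ∈ 𝓝 p₀, ∃ V : Set Q, IsOpen V ∧ Set.MapsTo Φ W V ∧
      ∃ D : ∀ q : Q, Submodule ℝ (TangentSpace 𝓘(ℝ, E') q),
        IsSmoothDistributionOn D V ∧ (∀ p ∈ W, D (Φ p) = rangeDist E E' Φ p) ∧
        ∀ (a b : ℝ) (η : ℝ → Q), IsGeodesicOn E' η (Set.Ioo a b) →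
          Set.MapsTo η (Set.Ioo a b) V →
            ∃ k : ℝ, ∀ t ∈ Set.Ioo a b,
              s (η t) * Real.sin (InnerProductGeometry.angle (velocity E' η t)
                ((D (η t))ᗮ.starProjection (velocity E' η t))) = k

end Maps

end SlantMaps

end

/-! Write S for the second fundamental form of the map `Φ`, T for the orthogonal projection onto the
distribution D of the Clairaut condition, and W = Φ_*Y. S is a symmetric tensor
(`secondFundamentalForm_eq_sff`, `sff_symm`), so everything reduces to pointwise statements about
`sff`.

Slant side. The slant condition gives α² = -cos²θ on the range (`opAlpha_opAlpha`). Differentiating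
JW = αW + δW and applying J once more, with ∇J = 0, yields (cos²θ - 1)∇W = ∇(δαW) + J∇(δW)
(`covAlong_slant`). Hence the left side of (iii) is the tangential part of ∇(δαW), plus J of the
tangential part of ∇(δW), minus (cos²θ - 1)S(X,Y) (`slantIdentity_lhs`). If S = 0, derivatives of
normal fields have no tangential part, since they are adjoint to those of tangential fields, so
(iii) holds. Conditions (i) and (ii) then follow from the Gauss formula and metric compatibility.

Clairaut side. Squaring the relation along a geodesic gives e^{2f}⟨Tη',η'⟩ = k²|η'|². Its derivative
at time 0 is 2df(v)⟨Tv,v⟩ + ⟨(∇_vT)v,v⟩ = 0 (`clairaut_quadratic`). With v = w ± u, w tangential and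
u normal, the part odd in u is ⟨(∇_wT)w,u⟩ = -df(u)|w|² (`clairaut_projection`). Along the map this
says ⟨S(x,y),u⟩ = -df(u)⟨Φ_*x,Φ_*y⟩ (`IsClairaut.inner_sff`).

Converse. On horizontal vectors S is normal (`IsRiemannianMap.inner_sff_push`), so it vanishes there
once df kills the normal space. Pairing (iii) with a normal u gives -sin²θ df(u)⟨w,w'⟩ +
df(δw')⟨δw,u⟩ = 0 (`SlantIdentity.inner_normal`). If sin θ ≠ 0 and the range contains v ≠ 0
orthogonal to w, the triple (v, w, δv) gives df(δw) = 0, and then (w, w, u) gives df(u) = 0. In rank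
1 no such v exists. If sin θ = 0 the range is J-invariant, and comparing ∇(JW) with J∇W forces df =
0 on normal vectors without using (iii). Conditions (i) and (ii) dispose of the remaining components
of S (`IsRiemannianMap.sff_eq_zero`). -/

noncomputable section

set_option maxSynthPendingDepth 3
set_option linter.unusedSectionVars false

namespace SlantMaps

/-! ### Smooth vector fields along maps, in chart components. -/

section SmoothFields

variable {E : Type*} [NormedAddCommGroup E] [NormedSpace ℝ E]
  {M : Type*} [TopologicalSpace M] [ChartedSpace E M] [IsManifold 𝓘(ℝ, E) ∞ M]
  {E' : Type*} [NormedAddCommGroup E'] [NormedSpace ℝ E']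
  {N : Type*} [TopologicalSpace N] [ChartedSpace E' N]

theorem toCoord_ofCoord {c x : M} (hx : x ∈ (chartAt E c).source) (e : E) :
    toCoord c x (ofCoord c x e) = e :=
  (trivializationAt E (fun x : M => TangentSpace 𝓘(ℝ, E) x) c).continuousLinearMapAt_symmL hx e

theorem ofCoord_toCoord {c x : M} (hx : x ∈ (chartAt E c).source) (v : TangentSpace 𝓘(ℝ, E) x) :
    ofCoord c x (toCoord c x v) = v :=
  (trivializationAt E (fun x : M => TangentSpace 𝓘(ℝ, E) x) c).symmL_continuousLinearMapAt hx v

theorem toCoord_self_ofCoord (x : M) (e : E) : toCoord x x (ofCoord x x e) = e :=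
  toCoord_ofCoord (mem_chart_source E x) e

theorem ofCoord_self_toCoord (x : M) (v : TangentSpace 𝓘(ℝ, E) x) :
    ofCoord x x (toCoord x x v) = v :=
  ofCoord_toCoord (mem_chart_source E x) v

theorem toCoord_self_injective (x : M) :
    Function.Injective (toCoord x x : TangentSpace 𝓘(ℝ, E) x → E) :=
  Function.LeftInverse.injective (ofCoord_self_toCoord x)

theorem toCoord_eq_mfderiv {c x : M} (hx : x ∈ (chartAt E c).source) :
    toCoord c x = mfderiv 𝓘(ℝ, E) 𝓘(ℝ, E) (extChartAt 𝓘(ℝ, E) c) x :=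
  TangentBundle.continuousLinearMapAt_trivializationAt hx

variable (E') in
/-- A vector field `V` along the map `F` is smooth at `x`. -/
def SmoothAlongAt (F : N → M) (V : ∀ x : N, TangentSpace 𝓘(ℝ, E) (F x)) (x : N) : Prop :=
  ContMDiffAt 𝓘(ℝ, E') 𝓘(ℝ, E).tangent ∞
    (fun x' => (⟨F x', V x'⟩ : TangentBundle 𝓘(ℝ, E) M)) x

/-- Any chart whose domain contains `F x` may be used, because the trivializations of the tangent
bundle are smooth; all later smoothness claims are checked on components. -/
theorem smoothAlongAt_iff {c : M} {F : N → M} {V : ∀ x : N, TangentSpace 𝓘(ℝ, E) (F x)} {x : N}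
    (hc : F x ∈ (chartAt E c).source) :
    SmoothAlongAt E' F V x ↔ ContMDiffAt 𝓘(ℝ, E') 𝓘(ℝ, E) ∞ F x ∧
      ContMDiffAt 𝓘(ℝ, E') 𝓘(ℝ, E) ∞ (fun x' => toCoord c (F x') (V x')) x := by
  unfold SmoothAlongAt
  rw [(trivializationAt E (fun x : M => TangentSpace 𝓘(ℝ, E) x) c).contMDiffAt_iff
    (f := fun x' => (⟨F x', V x'⟩ : TangentBundle 𝓘(ℝ, E) M))
    (by rw [Trivialization.mem_source]; exact hc)]
  refine and_congr_right fun hF => ?_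
  refine Filter.EventuallyEq.contMDiffAt_iff ?_
  have h1 : ∀ᶠ x' in 𝓝 x, F x' ∈ (chartAt E c).source :=
    hF.continuousAt.eventually_mem ((chartAt E c).open_source.mem_nhds hc)
  filter_upwards [h1] with x' hx'
  exact ((trivializationAt E (fun x : M => TangentSpace 𝓘(ℝ, E) x)
    c).continuousLinearMapAt_apply_of_mem ℝ hx' (V x')).symm

theorem smoothAlongAt_iff_self {F : N → M} {V : ∀ x : N, TangentSpace 𝓘(ℝ, E) (F x)} {x : N} :
    SmoothAlongAt E' F V x ↔ ContMDiffAt 𝓘(ℝ, E') 𝓘(ℝ, E) ∞ F x ∧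
      ContMDiffAt 𝓘(ℝ, E') 𝓘(ℝ, E) ∞ (fun x' => toCoord (F x) (F x') (V x')) x :=
  smoothAlongAt_iff (mem_chart_source E (F x))

namespace SmoothAlongAt

variable {F : N → M} {V W : ∀ x : N, TangentSpace 𝓘(ℝ, E) (F x)} {x : N}

theorem base (hV : SmoothAlongAt E' F V x) : ContMDiffAt 𝓘(ℝ, E') 𝓘(ℝ, E) ∞ F x :=
  (smoothAlongAt_iff_self.1 hV).1

theorem coord (hV : SmoothAlongAt E' F V x) :
    ContMDiffAt 𝓘(ℝ, E') 𝓘(ℝ, E) ∞ (fun x' => toCoord (F x) (F x') (V x')) x :=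
  (smoothAlongAt_iff_self.1 hV).2

theorem congr (hV : SmoothAlongAt E' F V x) (h : ∀ᶠ x' in 𝓝 x, W x' = V x') :
    SmoothAlongAt E' F W x := by
  refine ContMDiffAt.congr_of_eventuallyEq hV ?_
  filter_upwards [h] with x' hx'
  rw [hx']

theorem add (hV : SmoothAlongAt E' F V x) (hW : SmoothAlongAt E' F W x) :
    SmoothAlongAt E' F (fun x' => V x' + W x') x := by
  rw [smoothAlongAt_iff_self]
  refine ⟨hV.base, ?_⟩
  simp only [map_add]
  exact hV.coord.add hW.coord

theorem smul {a : N → ℝ} (ha : ContMDiffAt 𝓘(ℝ, E') 𝓘(ℝ, ℝ) ∞ a x) (hV : SmoothAlongAt E' F V x) :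
    SmoothAlongAt E' F (fun x' => a x' • V x') x := by
  rw [smoothAlongAt_iff_self]
  refine ⟨hV.base, ?_⟩
  simp only [map_smul]
  exact ha.smul hV.coord

theorem const_smul (a : ℝ) (hV : SmoothAlongAt E' F V x) :
    SmoothAlongAt E' F (fun x' => a • V x') x :=
  smul contMDiffAt_const hV

theorem neg (hV : SmoothAlongAt E' F V x) : SmoothAlongAt E' F (fun x' => -V x') x := by
  simpa using hV.const_smul (-1)

theorem sub (hV : SmoothAlongAt E' F V x) (hW : SmoothAlongAt E' F W x) :
    SmoothAlongAt E' F (fun x' => V x' - W x') x := by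
  simpa [sub_eq_add_neg] using hV.add hW.neg

theorem ofCoord_const (hF : ContMDiffAt 𝓘(ℝ, E') 𝓘(ℝ, E) ∞ F x) (e : E) :
    SmoothAlongAt E' F (fun x' => ofCoord (F x) (F x') e) x := by
  rw [smoothAlongAt_iff_self]
  refine ⟨hF, ?_⟩
  refine (contMDiffAt_const (c := e)).congr_of_eventuallyEq ?_
  filter_upwards [hF.continuousAt.eventually_mem (chart_source_mem_nhds E (F x))] with x' hx'
  exact toCoord_ofCoord hx' e

end SmoothAlongAt

variable {F : N → M} {V W : ∀ x : N, TangentSpace 𝓘(ℝ, E) (F x)} {x : N} in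
theorem SmoothAlongAt.mdifferentiableAt_coord (hV : SmoothAlongAt E' F V x) :
    MDifferentiableAt 𝓘(ℝ, E') 𝓘(ℝ, E) (fun x' => toCoord (F x) (F x') (V x')) x :=
  hV.coord.mdifferentiableAt (by simp)

variable {F : N → M} {V W : ∀ x : N, TangentSpace 𝓘(ℝ, E) (F x)} {x : N} in
theorem SmoothAlongAt.mdifferentiableAt_base (hV : SmoothAlongAt E' F V x) :
    MDifferentiableAt 𝓘(ℝ, E') 𝓘(ℝ, E) F x :=
  hV.base.mdifferentiableAt (by simp)

theorem IsSmoothFieldOn.smoothAlongAt {Y : ∀ x : M, TangentSpace 𝓘(ℝ, E) x} {s : Set M} {x : M}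
    (hY : IsSmoothFieldOn Y s) (hs : s ∈ 𝓝 x) : SmoothAlongAt E (fun y : M => y) Y x :=
  ContMDiffOn.contMDiffAt hY hs

theorem isSmoothFieldOn_univ_iff {Y : ∀ x : M, TangentSpace 𝓘(ℝ, E) x} :
    IsSmoothFieldOn Y Set.univ ↔ ∀ x, SmoothAlongAt E (fun y : M => y) Y x :=
  ⟨fun h _ => h.smoothAlongAt Filter.univ_mem, fun h => contMDiffOn_univ.2 h⟩

/-- Every smooth local vector field agrees near a given point with a smooth global one. -/
theorem exists_smooth_extension [FiniteDimensional ℝ E] [T2Space M] (x : M) (e : E) :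
    ∃ Z : ∀ y : M, TangentSpace 𝓘(ℝ, E) y, IsSmoothFieldOn Z Set.univ ∧
      ∀ᶠ y in 𝓝 x, Z y = ofCoord x y e := by
  let b : SmoothBumpFunction 𝓘(ℝ, E) x := Classical.arbitrary _
  refine ⟨fun y => b y • ofCoord x y e, ?_, ?_⟩
  · rw [isSmoothFieldOn_univ_iff]
    intro y
    -- On the support of the bump function the chart at `x` is available; off it the field is
    -- locally zero.
    by_cases hy : y ∈ tsupport b
    · have hys : y ∈ (chartAt E x).source := b.tsupport_subset_chartAt_source hy
      rw [smoothAlongAt_iff hys]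
      refine ⟨contMDiffAt_id, ?_⟩
      refine (b.contMDiffAt.smul (contMDiffAt_const (c := e))).congr_of_eventuallyEq ?_
      filter_upwards [(chartAt E x).open_source.mem_nhds hys] with z hz
      rw [map_smul, toCoord_ofCoord hz]
      rfl
    · have h0 : SmoothAlongAt E (fun y : M => y) (fun y : M => (0 : TangentSpace 𝓘(ℝ, E) y)) y := by
        rw [smoothAlongAt_iff_self]
        exact ⟨contMDiffAt_id, by simpa using contMDiffAt_const⟩
      refine h0.congr ?_
      filter_upwards [(isClosed_tsupport b).isOpen_compl.mem_nhds hy] with z hz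
      rw [image_eq_zero_of_notMem_tsupport hz, zero_smul]
  · filter_upwards [b.eventuallyEq_one] with y hy
    rw [hy]
    simp

theorem exists_smooth_extension_vector [FiniteDimensional ℝ E] [T2Space M] (x : M)
    (v : TangentSpace 𝓘(ℝ, E) x) :
    ∃ Z : ∀ y : M, TangentSpace 𝓘(ℝ, E) y, IsSmoothFieldOn Z Set.univ ∧ Z x = v := by
  obtain ⟨Z, hZ, h⟩ := exists_smooth_extension x (toCoord x x v)
  exact ⟨Z, hZ, by rw [h.self_of_nhds, ofCoord_self_toCoord]⟩

variable {E₂ : Type*} [NormedAddCommGroup E₂] [NormedSpace ℝ E₂]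
  {P : Type*} [TopologicalSpace P] [ChartedSpace E₂ P] [IsManifold 𝓘(ℝ, E₂) ∞ P]

theorem SmoothAlongAt.mfderiv {Φ : P → M} (hΦ : ContMDiff 𝓘(ℝ, E₂) 𝓘(ℝ, E) ∞ Φ)
    {F : N → P} {V : ∀ x : N, TangentSpace 𝓘(ℝ, E₂) (F x)} {x : N} (hV : SmoothAlongAt E' F V x) :
    SmoothAlongAt E' (fun x' => Φ (F x')) (fun x' => mfderiv 𝓘(ℝ, E₂) 𝓘(ℝ, E) Φ (F x') (V x')) x := by
  have h : ContMDiff 𝓘(ℝ, E₂).tangent 𝓘(ℝ, E).tangent ∞ (tangentMap 𝓘(ℝ, E₂) 𝓘(ℝ, E) Φ) :=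
    hΦ.contMDiff_tangentMap (by simp)
  exact ContMDiffAt.comp x (h _) hV

end SmoothFields

/-! ### Leibniz and chain rules for derivatives of vector-valued functions on a manifold. -/

section Calculus

variable {E' : Type*} [NormedAddCommGroup E'] [NormedSpace ℝ E']
  {N : Type*} [TopologicalSpace N] [ChartedSpace E' N]
  {F : Type*} [NormedAddCommGroup F] [NormedSpace ℝ F]
  {G : Type*} [NormedAddCommGroup G] [NormedSpace ℝ G]

/-- The model has no boundary, so the derivative within the range of the model is an ordinary one
and the product rule of normed spaces applies. -/
theorem hasFDerivAt_mvfderiv {f : N → F} {x : N} (hf : MDifferentiableAt 𝓘(ℝ, E') 𝓘(ℝ, F) f x) :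
    HasFDerivAt (𝕜 := ℝ) (E := E') (fun z => f ((extChartAt 𝓘(ℝ, E') x).symm z))
      (mvfderiv 𝓘(ℝ, E') f x) (extChartAt 𝓘(ℝ, E') x x) := by
  have h : HasFDerivWithinAt (𝕜 := ℝ) (E := E') (F := F)
      (writtenInExtChartAt 𝓘(ℝ, E') 𝓘(ℝ, F) x f) (mfderiv 𝓘(ℝ, E') 𝓘(ℝ, F) f x)
      (Set.range 𝓘(ℝ, E')) (extChartAt 𝓘(ℝ, E') x x) := hf.hasMFDerivAt.2
  exact h.hasFDerivAt (by simp)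

theorem mvfderiv_eq_of_hasFDerivAt {f : N → F} {x : N}
    (hf : MDifferentiableAt 𝓘(ℝ, E') 𝓘(ℝ, F) f x) {f' : E' →L[ℝ] F}
    (h : HasFDerivAt (fun z => f ((extChartAt 𝓘(ℝ, E') x).symm z)) f' (extChartAt 𝓘(ℝ, E') x x))
    (ξ : E') : mvfderiv 𝓘(ℝ, E') f x ξ = f' ξ := by
  let L : E' →L[ℝ] F := mvfderiv 𝓘(ℝ, E') f x
  have hL : HasFDerivAt (fun z => f ((extChartAt 𝓘(ℝ, E') x).symm z)) L
      (extChartAt 𝓘(ℝ, E') x x) := hasFDerivAt_mvfderiv hf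
  exact congrArg (fun A : E' →L[ℝ] F => A ξ) (hL.unique h)

theorem mvfderiv_congr {f g : N → F} {x : N} (h : f =ᶠ[𝓝 x] g) (ξ : TangentSpace 𝓘(ℝ, E') x) :
    mvfderiv 𝓘(ℝ, E') f x ξ = mvfderiv 𝓘(ℝ, E') g x ξ := by
  unfold mvfderiv
  exact DFunLike.congr_fun h.mfderiv_eq ξ

theorem mvfderiv_clm_apply {A : N → F →L[ℝ] G} {v : N → F} {x : N}
    (hA : MDifferentiableAt 𝓘(ℝ, E') 𝓘(ℝ, F →L[ℝ] G) A x)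
    (hv : MDifferentiableAt 𝓘(ℝ, E') 𝓘(ℝ, F) v x) (ξ : TangentSpace 𝓘(ℝ, E') x) :
    mvfderiv 𝓘(ℝ, E') (fun x' => A x' (v x')) x ξ
      = mvfderiv 𝓘(ℝ, E') A x ξ (v x) + A x (mvfderiv 𝓘(ℝ, E') v x ξ) := by
  have h := (hasFDerivAt_mvfderiv hA).clm_apply (hasFDerivAt_mvfderiv hv)
  have hd : MDifferentiableAt 𝓘(ℝ, E') 𝓘(ℝ, G) (fun x' => A x' (v x')) x := hA.clm_apply hv
  rw [mvfderiv_eq_of_hasFDerivAt hd h ξ]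
  simp only [extChartAt_to_inv]
  exact add_comm _ _

theorem mvfderiv_comp_fderiv {g : F → G} {y : N → F} {x : N} (hg : DifferentiableAt ℝ g (y x))
    (hy : MDifferentiableAt 𝓘(ℝ, E') 𝓘(ℝ, F) y x) (ξ : TangentSpace 𝓘(ℝ, E') x) :
    mvfderiv 𝓘(ℝ, E') (fun x' => g (y x')) x ξ = fderiv ℝ g (y x) (mvfderiv 𝓘(ℝ, E') y x ξ) := by
  have hg' : HasFDerivAt g (fderiv ℝ g (y x))
      (y ((extChartAt 𝓘(ℝ, E') x).symm (extChartAt 𝓘(ℝ, E') x x))) := by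
    rw [extChartAt_to_inv]
    exact hg.hasFDerivAt
  have h := hg'.comp (extChartAt 𝓘(ℝ, E') x x) (hasFDerivAt_mvfderiv hy)
  have hd : MDifferentiableAt 𝓘(ℝ, E') 𝓘(ℝ, G) (fun x' => g (y x')) x :=
    hg.mdifferentiableAt.comp x hy
  rw [mvfderiv_eq_of_hasFDerivAt hd h ξ]
  rfl

variable {E : Type*} [NormedAddCommGroup E] [NormedSpace ℝ E]
  {M : Type*} [TopologicalSpace M] [ChartedSpace E M]

theorem mvfderiv_comp_mfderiv {f : M → F} {Φ : N → M} {x : N}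
    (hf : MDifferentiableAt 𝓘(ℝ, E) 𝓘(ℝ, F) f (Φ x))
    (hΦ : MDifferentiableAt 𝓘(ℝ, E') 𝓘(ℝ, E) Φ x) (ξ : TangentSpace 𝓘(ℝ, E') x) :
    mvfderiv 𝓘(ℝ, E') (fun x' => f (Φ x')) x ξ
      = mvfderiv 𝓘(ℝ, E) f (Φ x) (mfderiv 𝓘(ℝ, E') 𝓘(ℝ, E) Φ x ξ) :=
  mfderiv_comp_apply x hf hΦ ξ

theorem mvfderiv_chart [IsManifold 𝓘(ℝ, E) ∞ M] {Φ : N → M} {x : N}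
    (hΦ : MDifferentiableAt 𝓘(ℝ, E') 𝓘(ℝ, E) Φ x) {c : M} (hc : Φ x ∈ (chartAt E c).source)
    (ξ : TangentSpace 𝓘(ℝ, E') x) :
    mvfderiv 𝓘(ℝ, E') (fun x' => extChartAt 𝓘(ℝ, E) c (Φ x')) x ξ
      = toCoord c (Φ x) (mfderiv 𝓘(ℝ, E') 𝓘(ℝ, E) Φ x ξ) := by
  rw [mvfderiv_comp_mfderiv (mdifferentiableAt_extChartAt hc) hΦ, toCoord_eq_mfderiv hc]
  rfl

theorem mdifferentiableAt_chart [IsManifold 𝓘(ℝ, E) ∞ M] {Φ : N → M} {x : N}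
    (hΦ : MDifferentiableAt 𝓘(ℝ, E') 𝓘(ℝ, E) Φ x) {c : M} (hc : Φ x ∈ (chartAt E c).source) :
    MDifferentiableAt 𝓘(ℝ, E') 𝓘(ℝ, E) (fun x' => extChartAt 𝓘(ℝ, E) c (Φ x')) x :=
  (mdifferentiableAt_extChartAt hc).comp x hΦ

end Calculus

/-! ### Christoffel symbols of a metric on an open subset of a vector space. -/

section Koszul

variable {E : Type*} [NormedAddCommGroup E] [NormedSpace ℝ E]

/-- The Christoffel symbols of a metric `g` on an open subset of a vector space. -/
def koszul (g : E → E →L[ℝ] E →L[ℝ] ℝ) (y u v : E) : E :=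
  (g y).inverse ((1 / 2 : ℝ) • (fderiv ℝ g y u v + fderiv ℝ g y v u
    - ((fderiv ℝ g y).flip u).flip v))

variable (g : E → E →L[ℝ] E →L[ℝ] ℝ) (y u v w : E)

theorem koszul_add_right : koszul g y u (v + w) = koszul g y u v + koszul g y u w := by
  unfold koszul
  rw [← map_add, ← smul_add]
  congr 2
  ext z
  simp
  ring

theorem koszul_smul_right (a : ℝ) : koszul g y u (a • v) = a • koszul g y u v := by
  unfold koszul
  rw [← map_smul, smul_comm a]
  congr 2
  ext z
  simp
  ring

theorem koszul_add_left : koszul g y (u + v) w = koszul g y u w + koszul g y v w := by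
  unfold koszul
  rw [← map_add, ← smul_add]
  congr 2
  ext z
  simp
  ring

variable {g y}

theorem apply_koszul (hy : (g y).IsInvertible) :
    g y (koszul g y u v) w
      = (1 / 2 : ℝ) * (fderiv ℝ g y u v w + fderiv ℝ g y v u w - fderiv ℝ g y w u v) := by
  unfold koszul
  rw [hy.self_apply_inverse]
  simp

/-- Uniqueness of the derivative, applied to the two sides of g(v,w) = g(w,v). -/
theorem fderiv_apply_symm (hg : DifferentiableAt ℝ g y) (hsymm : ∀ z u v, g z u v = g z v u) :
    fderiv ℝ g y u v w = fderiv ℝ g y u w v := by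
  have hd := hg.hasFDerivAt
  have h1 := (hd.clm_apply (hasFDerivAt_const v y)).clm_apply (hasFDerivAt_const w y)
  have h2 := (hd.clm_apply (hasFDerivAt_const w y)).clm_apply (hasFDerivAt_const v y)
  simp_rw [fun z => hsymm z v w] at h1
  simpa using congrArg (fun L : E →L[ℝ] ℝ => L u) (h1.unique h2)

/-- Metric compatibility in coordinates: the last two terms of the Koszul formula change sign when v
and w are exchanged, so only the first survives the sum. -/
theorem apply_koszul_add (hy : (g y).IsInvertible) (hg : DifferentiableAt ℝ g y)
    (hsymm : ∀ z u v, g z u v = g z v u) :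
    g y (koszul g y u v) w + g y v (koszul g y u w) = fderiv ℝ g y u v w := by
  rw [hsymm y v, apply_koszul _ _ _ hy, apply_koszul _ _ _ hy,
    fderiv_apply_symm u w v hg hsymm, fderiv_apply_symm v u w hg hsymm,
    fderiv_apply_symm w u v hg hsymm]
  ring

theorem koszul_symm (hg : DifferentiableAt ℝ g y) (hsymm : ∀ z u v, g z u v = g z v u) :
    koszul g y u v = koszul g y v u := by
  unfold koszul
  congr 2
  ext w
  simp [fderiv_apply_symm w u v hg hsymm]
  ring

/-- The smoothness needed for the geodesic equation, where both arguments of the Christoffel symbol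
are the velocity. -/
theorem contDiffOn_koszul [FiniteDimensional ℝ E] {s : Set E} (hs : IsOpen s)
    (hg : ContDiffOn ℝ ∞ g s) (hinv : ∀ y ∈ s, (g y).IsInvertible) :
    ContDiffOn ℝ ∞ (fun z : E × E => koszul g z.1 z.2 z.2) (s ×ˢ Set.univ) := by
  have hfst : Set.MapsTo Prod.fst (s ×ˢ (Set.univ : Set E)) s := fun z hz => hz.1
  have hdg : ContDiffOn ℝ ∞ (fun z : E × E => fderiv ℝ g z.1) (s ×ˢ Set.univ) :=
    (hg.fderiv_of_isOpen (m := ∞) hs (by simp)).comp contDiffOn_fst hfst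
  have hinv : ContDiffOn ℝ ∞ (fun z : E × E => (g z.1).inverse) (s ×ˢ Set.univ) := by
    intro z hz
    obtain ⟨e, he⟩ := hinv z.1 hz.1
    have h1 : ContDiffAt ℝ ∞ (ContinuousLinearMap.inverse : (E →L[ℝ] E →L[ℝ] ℝ) → _)
        (g z.1) := he ▸ contDiffAt_map_inverse e
    exact h1.comp_contDiffWithinAt z ((hg.comp contDiffOn_fst hfst) z hz)
  unfold koszul
  have hu : ContDiffOn ℝ ∞ (fun z : E × E => z.2) (s ×ˢ Set.univ) := contDiffOn_snd
  have h1 := (hdg.clm_apply hu).clm_apply hu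
  have h2 : ContDiffOn ℝ ∞ (fun z : E × E => ((fderiv ℝ g z.1).flip z.2).flip z.2)
      (s ×ˢ Set.univ) := by
    rw [contDiffOn_clm_apply]
    intro w
    exact (((hdg.clm_apply (contDiffOn_const (c := w))).clm_apply hu).clm_apply hu)
  exact hinv.clm_apply (((h1.add h1).sub h2).const_smul _)

end Koszul

/-! ### The Riemannian metric in a chart. -/

section Metric

variable {E : Type*} [NormedAddCommGroup E] [NormedSpace ℝ E]
  {M : Type*} [TopologicalSpace M] [ChartedSpace E M] [IsManifold 𝓘(ℝ, E) ∞ M]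
  [RiemannianBundle (fun x : M => TangentSpace 𝓘(ℝ, E) x)]

theorem metricCoord_apply (c : M) (y e e' : E) :
    metricCoord c y e e' = inner ℝ (ofCoord c ((extChartAt 𝓘(ℝ, E) c).symm y) e)
      (ofCoord c ((extChartAt 𝓘(ℝ, E) c).symm y) e') :=
  rfl

theorem metricCoord_symm (c : M) (y e e' : E) : metricCoord c y e e' = metricCoord c y e' e := by
  rw [metricCoord_apply, metricCoord_apply, real_inner_comm]

theorem inner_eq_metricCoord {c x : M} (hx : x ∈ (chartAt E c).source)
    (v w : TangentSpace 𝓘(ℝ, E) x) :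
    inner ℝ v w = metricCoord c (extChartAt 𝓘(ℝ, E) c x) (toCoord c x v) (toCoord c x w) := by
  have hx' : x ∈ (extChartAt 𝓘(ℝ, E) c).source := by rwa [extChartAt_source]
  rw [metricCoord_apply, (extChartAt 𝓘(ℝ, E) c).left_inv hx', ofCoord_toCoord hx,
    ofCoord_toCoord hx]

omit [IsManifold 𝓘(ℝ, E) ∞ M] [RiemannianBundle (fun x : M => TangentSpace 𝓘(ℝ, E) x)] in
theorem extChartAt_symm_mem {c : M} {y : E} (hy : y ∈ (extChartAt 𝓘(ℝ, E) c).target) :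
    (extChartAt 𝓘(ℝ, E) c).symm y ∈ (chartAt E c).source := by
  have := (extChartAt 𝓘(ℝ, E) c).map_target hy
  rwa [extChartAt_source] at this

theorem SmoothAlongAt.inner {E' : Type*} [NormedAddCommGroup E'] [NormedSpace ℝ E']
    {N : Type*} [TopologicalSpace N] [ChartedSpace E' N]
    [IsContMDiffRiemannianBundle 𝓘(ℝ, E) ∞ E (fun x : M => TangentSpace 𝓘(ℝ, E) x)]
    {F : N → M} {V W : ∀ x : N, TangentSpace 𝓘(ℝ, E) (F x)} {x : N}
    (hV : SmoothAlongAt E' F V x) (hW : SmoothAlongAt E' F W x) :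
    ContMDiffAt 𝓘(ℝ, E') 𝓘(ℝ, ℝ) ∞ (fun x' => inner ℝ (V x') (W x')) x := by
  refine ContMDiffAt.inner_bundle (IB := 𝓘(ℝ, E)) (F := E)
    (E := fun x : M => TangentSpace 𝓘(ℝ, E) x) (b := F) (v := V) (w := W) ?_ ?_
  · exact hV
  · exact hW

theorem contDiffOn_metricCoord [FiniteDimensional ℝ E]
    [IsContMDiffRiemannianBundle 𝓘(ℝ, E) ∞ E (fun x : M => TangentSpace 𝓘(ℝ, E) x)] (c : M) :
    ContDiffOn ℝ ∞ (metricCoord (E := E) c) (extChartAt 𝓘(ℝ, E) c).target := by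
  rw [contDiffOn_clm_apply]
  intro e
  rw [contDiffOn_clm_apply]
  intro e'
  rw [← contMDiffOn_iff_contDiffOn]
  have hsm : ∀ e : E, ∀ y ∈ (extChartAt 𝓘(ℝ, E) c).target,
      SmoothAlongAt E (fun y : E => (extChartAt 𝓘(ℝ, E) c).symm y)
        (fun y => ofCoord c ((extChartAt 𝓘(ℝ, E) c).symm y) e) y := by
    intro e y hy
    rw [smoothAlongAt_iff (extChartAt_symm_mem hy)]
    refine ⟨(contMDiffOn_extChartAt_symm c).contMDiffAt
      ((isOpen_extChartAt_target c).mem_nhds hy), ?_⟩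
    refine (contMDiffAt_const (c := e)).congr_of_eventuallyEq ?_
    filter_upwards [(isOpen_extChartAt_target c).mem_nhds hy] with z hz
    exact toCoord_ofCoord (extChartAt_symm_mem hz) e
  intro y hy
  exact ((hsm e y hy).inner (hsm e' y hy)).contMDiffWithinAt

/-- Positive definiteness gives injectivity, and E has the dimension of its dual. -/
theorem isInvertible_metricCoord [FiniteDimensional ℝ E] {c : M} {y : E}
    (hy : y ∈ (extChartAt 𝓘(ℝ, E) c).target) : (metricCoord c y).IsInvertible := by
  have hinj : Function.Injective (metricCoord c y) := by
    rw [injective_iff_map_eq_zero]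
    intro e he
    have h0 : metricCoord c y e e = 0 := by rw [he]; rfl
    rw [metricCoord_apply, inner_self_eq_zero] at h0
    rw [← toCoord_ofCoord (extChartAt_symm_mem hy) e, h0, map_zero]
  have hdim : Module.finrank ℝ E = Module.finrank ℝ (E →L[ℝ] ℝ) := by
    rw [← (LinearMap.toContinuousLinearMap (𝕜 := ℝ) (E := E) (F' := ℝ)).finrank_eq]
    exact (Subspace.dual_finrank_eq (K := ℝ) (V := E)).symm
  let L : E ≃ₗ[ℝ] (E →L[ℝ] ℝ) :=
    LinearMap.linearEquivOfInjective (metricCoord c y).toLinearMap hinj hdim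
  exact ⟨L.toContinuousLinearEquiv, by ext e; rfl⟩

theorem christoffel_add_right (c : M) (y u v w : E) :
    christoffel c y u (v + w) = christoffel c y u v + christoffel c y u w :=
  koszul_add_right (metricCoord c) y u v w

theorem christoffel_smul_right (c : M) (y u v : E) (a : ℝ) :
    christoffel c y u (a • v) = a • christoffel c y u v :=
  koszul_smul_right (metricCoord c) y u v a

theorem christoffel_add_left (c : M) (y u v w : E) :
    christoffel c y (u + v) w = christoffel c y u w + christoffel c y v w :=
  koszul_add_left (metricCoord c) y u v w

variable [FiniteDimensional ℝ E]
  [IsContMDiffRiemannianBundle 𝓘(ℝ, E) ∞ E (fun x : M => TangentSpace 𝓘(ℝ, E) x)]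

theorem differentiableAt_metricCoord {c : M} {y : E} (hy : y ∈ (extChartAt 𝓘(ℝ, E) c).target) :
    DifferentiableAt ℝ (metricCoord (E := E) c) y :=
  ((contDiffOn_metricCoord c).contDiffAt ((isOpen_extChartAt_target c).mem_nhds hy)).differentiableAt
    (by simp)

theorem metricCoord_christoffel_add {c : M} {y : E} (hy : y ∈ (extChartAt 𝓘(ℝ, E) c).target)
    (u v w : E) :
    metricCoord c y (christoffel c y u v) w + metricCoord c y v (christoffel c y u w)
      = fderiv ℝ (metricCoord c) y u v w :=
  apply_koszul_add u v w (isInvertible_metricCoord hy) (differentiableAt_metricCoord hy)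
    (metricCoord_symm c)

theorem christoffel_symm {c : M} {y : E} (hy : y ∈ (extChartAt 𝓘(ℝ, E) c).target) (u v : E) :
    christoffel c y u v = christoffel c y v u :=
  koszul_symm u v (differentiableAt_metricCoord hy) (metricCoord_symm c)

theorem contDiffOn_christoffel (c : M) :
    ContDiffOn ℝ ∞ (fun z : E × E => christoffel c z.1 z.2 z.2)
      ((extChartAt 𝓘(ℝ, E) c).target ×ˢ Set.univ) :=
  contDiffOn_koszul (isOpen_extChartAt_target c) (contDiffOn_metricCoord c)
    fun _ hy => isInvertible_metricCoord hy

end Metric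

/-! ### Linearity and metric compatibility of the pullback connection. -/

section CovariantDerivative

variable {E : Type*} [NormedAddCommGroup E] [NormedSpace ℝ E]
  {M : Type*} [TopologicalSpace M] [ChartedSpace E M] [IsManifold 𝓘(ℝ, E) ∞ M]
  [RiemannianBundle (fun x : M => TangentSpace 𝓘(ℝ, E) x)]
  {E' : Type*} [NormedAddCommGroup E'] [NormedSpace ℝ E']
  {N : Type*} [TopologicalSpace N] [ChartedSpace E' N]
  {F : N → M} {V W : ∀ x : N, TangentSpace 𝓘(ℝ, E) (F x)} {x : N}

theorem toCoord_covAlong (F : N → M) (V : ∀ x : N, TangentSpace 𝓘(ℝ, E) (F x)) (x : N)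
    (ξ : TangentSpace 𝓘(ℝ, E') x) :
    toCoord (F x) (F x) (covAlong F V x ξ)
      = mvfderiv 𝓘(ℝ, E') (fun x' : N => toCoord (F x) (F x') (V x')) x ξ
        + christoffel (F x) (extChartAt 𝓘(ℝ, E) (F x) (F x))
          (toCoord (F x) (F x) (mfderiv 𝓘(ℝ, E') 𝓘(ℝ, E) F x ξ)) (toCoord (F x) (F x) (V x)) :=
  toCoord_self_ofCoord _ _

theorem covAlong_congr (h : ∀ᶠ x' in 𝓝 x, V x' = W x') (ξ : TangentSpace 𝓘(ℝ, E') x) :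
    covAlong F V x ξ = covAlong F W x ξ := by
  apply toCoord_self_injective
  rw [toCoord_covAlong, toCoord_covAlong, h.self_of_nhds]
  congr 1
  refine mvfderiv_congr ?_ ξ
  filter_upwards [h] with x' hx'
  rw [hx']

theorem covAlong_add (hV : SmoothAlongAt E' F V x) (hW : SmoothAlongAt E' F W x)
    (ξ : TangentSpace 𝓘(ℝ, E') x) :
    covAlong F (fun x' => V x' + W x') x ξ = covAlong F V x ξ + covAlong F W x ξ := by
  apply toCoord_self_injective
  rw [map_add, toCoord_covAlong, toCoord_covAlong, toCoord_covAlong]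
  simp only [map_add, christoffel_add_right]
  have h := mvfderiv_add hV.mdifferentiableAt_coord hW.mdifferentiableAt_coord
  rw [show (fun x' => toCoord (F x) (F x') (V x') + toCoord (F x) (F x') (W x'))
    = (fun x' => toCoord (F x) (F x') (V x')) + fun x' => toCoord (F x) (F x') (W x') from rfl, h]
  rw [add_apply]
  abel

theorem covAlong_const_smul (hV : SmoothAlongAt E' F V x) (a : ℝ)
    (ξ : TangentSpace 𝓘(ℝ, E') x) :
    covAlong F (fun x' => a • V x') x ξ = a • covAlong F V x ξ := by
  apply toCoord_self_injective
  rw [map_smul, toCoord_covAlong, toCoord_covAlong]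
  simp only [map_smul, christoffel_smul_right, smul_add]
  congr 1
  have h := mvfderiv_comp_fderiv (E' := E') (g := a • ContinuousLinearMap.id ℝ E)
    (ContinuousLinearMap.differentiableAt _) hV.mdifferentiableAt_coord ξ
  rw [ContinuousLinearMap.fderiv] at h
  exact h

variable [FiniteDimensional ℝ E] [IsContMDiffRiemannianBundle 𝓘(ℝ, E) ∞ E (fun x : M => TangentSpace 𝓘(ℝ, E) x)]

/-- Metric compatibility of the pullback of the Levi-Civita connection. -/
theorem mvfderiv_inner (hV : SmoothAlongAt E' F V x) (hW : SmoothAlongAt E' F W x)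
    (ξ : TangentSpace 𝓘(ℝ, E') x) :
    mvfderiv 𝓘(ℝ, E') (fun x' => inner ℝ (V x') (W x')) x ξ
      = inner ℝ (covAlong F V x ξ) (W x) + inner ℝ (V x) (covAlong F W x ξ) := by
  have hsrc := mem_chart_source E (F x)
  have hy : extChartAt 𝓘(ℝ, E) (F x) (F x) ∈ (extChartAt 𝓘(ℝ, E) (F x)).target :=
    mem_extChartAt_target (F x)
  have hev : (fun x' => inner ℝ (V x') (W x')) =ᶠ[𝓝 x] fun x' =>
      metricCoord (F x) (extChartAt 𝓘(ℝ, E) (F x) (F x')) (toCoord (F x) (F x') (V x'))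
        (toCoord (F x) (F x') (W x')) := by
    filter_upwards [hV.base.continuousAt.eventually_mem (chart_source_mem_nhds E (F x))] with x' hx'
    exact inner_eq_metricCoord hx' _ _
  have hF := hV.mdifferentiableAt_base
  have hchart := mdifferentiableAt_chart hF hsrc
  have hg : MDifferentiableAt 𝓘(ℝ, E') 𝓘(ℝ, E →L[ℝ] E →L[ℝ] ℝ)
      (fun x' => metricCoord (F x) (extChartAt 𝓘(ℝ, E) (F x) (F x'))) x :=
    MDifferentiableAt.comp (g := metricCoord (F x)) x
      (differentiableAt_metricCoord hy).mdifferentiableAt hchart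
  rw [mvfderiv_congr hev, mvfderiv_clm_apply (hg.clm_apply hV.mdifferentiableAt_coord)
    hW.mdifferentiableAt_coord, mvfderiv_clm_apply hg hV.mdifferentiableAt_coord,
    mvfderiv_comp_fderiv (g := metricCoord (F x))
      (y := fun x' => extChartAt 𝓘(ℝ, E) (F x) (F x')) (differentiableAt_metricCoord hy) hchart, mvfderiv_chart hF hsrc,
    inner_eq_metricCoord hsrc, inner_eq_metricCoord hsrc, toCoord_covAlong, toCoord_covAlong,
    add_apply, map_add, map_add, add_apply,
    ← metricCoord_christoffel_add hy]
  ring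

end CovariantDerivative

/-! ### Covariant derivatives of fields of endomorphisms. -/

section Tensor

variable {E : Type*} [NormedAddCommGroup E] [NormedSpace ℝ E] [FiniteDimensional ℝ E]
  {M : Type*} [TopologicalSpace M] [ChartedSpace E M] [IsManifold 𝓘(ℝ, E) ∞ M]

/-- The field `T` of endomorphisms of the tangent spaces maps smooth vector fields to fields which
are smooth at `q`. -/
def SmoothOpAt (T : ∀ q : M, TangentSpace 𝓘(ℝ, E) q →L[ℝ] TangentSpace 𝓘(ℝ, E) q) (q : M) : Prop :=
  ∀ Z : ∀ x : M, TangentSpace 𝓘(ℝ, E) x, IsSmoothFieldOn Z Set.univ →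
    SmoothAlongAt E (fun y : M => y) (fun y => T y (Z y)) q

/-- Components of a field of endomorphisms in the chart centred at `c`. -/
def opCoord (c : M) (T : ∀ q : M, TangentSpace 𝓘(ℝ, E) q →L[ℝ] TangentSpace 𝓘(ℝ, E) q) (q : M) :
    E →L[ℝ] E :=
  (toCoord c q).comp ((T q).comp (ofCoord c q))

variable {E' : Type*} [NormedAddCommGroup E'] [NormedSpace ℝ E']
  {N : Type*} [TopologicalSpace N] [ChartedSpace E' N]
  {F : N → M} {V W : ∀ x : N, TangentSpace 𝓘(ℝ, E) (F x)} {x : N}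

variable {T : ∀ q : M, TangentSpace 𝓘(ℝ, E) q →L[ℝ] TangentSpace 𝓘(ℝ, E) q}

omit [FiniteDimensional ℝ E] in
theorem opCoord_toCoord {c q : M} (hq : q ∈ (chartAt E c).source) (v : TangentSpace 𝓘(ℝ, E) q) :
    opCoord c T q (toCoord c q v) = toCoord c q (T q v) := by
  unfold opCoord
  rw [ContinuousLinearMap.comp_apply, ContinuousLinearMap.comp_apply, ofCoord_toCoord hq]

theorem contMDiffAt_clm_of_apply {G : Type*} [NormedAddCommGroup G] [NormedSpace ℝ G] {A : N → E →L[ℝ] G} {x : N}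
    (h : ∀ e, ContMDiffAt 𝓘(ℝ, E') 𝓘(ℝ, G) ∞ (fun x' => A x' e) x) :
    ContMDiffAt 𝓘(ℝ, E') 𝓘(ℝ, E →L[ℝ] G) ∞ A x := by
  let b := Module.finBasis ℝ E
  have hA : A = fun x' => ∑ i, (b.coord i).toContinuousLinearMap.smulRight (A x' (b i)) := by
    funext x'
    ext e
    conv_lhs => rw [← b.sum_repr e, map_sum]
    simp
  rw [hA]
  refine contMDiffAt_finsetSum fun i _ => ?_
  exact (((ContinuousLinearMap.smulRightL ℝ E G)
    (b.coord i).toContinuousLinearMap).contMDiff).contMDiffAt.comp x (h (b i))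

omit [FiniteDimensional ℝ E] in
theorem eventually_opCoord (hV : SmoothAlongAt E' F V x) :
    (fun x' => toCoord (F x) (F x') (T (F x') (V x'))) =ᶠ[𝓝 x]
      fun x' => opCoord (F x) T (F x') (toCoord (F x) (F x') (V x')) := by
  filter_upwards [hV.base.continuousAt.eventually_mem (chart_source_mem_nhds E (F x))] with x' hx'
  exact (opCoord_toCoord hx' _).symm

variable [T2Space M]

/-- Applying T to global extensions of the coordinate fields shows that each column of its matrix is
smooth. -/
theorem SmoothOpAt.contMDiffAt_opCoord {q : M} (hT : SmoothOpAt T q) :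
    ContMDiffAt 𝓘(ℝ, E) 𝓘(ℝ, E →L[ℝ] E) ∞ (opCoord q T) q := by
  refine contMDiffAt_clm_of_apply fun e => ?_
  obtain ⟨Z, hZ, hZe⟩ := exists_smooth_extension q e
  refine (hT Z hZ).coord.congr_of_eventuallyEq ?_
  filter_upwards [hZe] with y hy
  rw [hy]
  rfl

theorem SmoothOpAt.apply (hT : SmoothOpAt T (F x)) (hV : SmoothAlongAt E' F V x) :
    SmoothAlongAt E' F (fun x' => T (F x') (V x')) x := by
  rw [smoothAlongAt_iff_self]
  refine ⟨hV.base, ContMDiffAt.congr_of_eventuallyEq ?_ (eventually_opCoord hV)⟩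
  exact (hT.contMDiffAt_opCoord.comp x hV.base).clm_apply hV.coord

variable [RiemannianBundle (fun x : M => TangentSpace 𝓘(ℝ, E) x)]

/-- The covariant derivative `(∇_w T) v` of a field `T` of endomorphisms. -/
def covOp (T : ∀ q : M, TangentSpace 𝓘(ℝ, E) q →L[ℝ] TangentSpace 𝓘(ℝ, E) q) (q : M)
    (w v : TangentSpace 𝓘(ℝ, E) q) : TangentSpace 𝓘(ℝ, E) q :=
  ofCoord q q (mvfderiv 𝓘(ℝ, E) (opCoord q T) q w (toCoord q q v)
      + christoffel q (extChartAt 𝓘(ℝ, E) q q) (toCoord q q w) (toCoord q q (T q v)))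
    - T q (ofCoord q q
      (christoffel q (extChartAt 𝓘(ℝ, E) q q) (toCoord q q w) (toCoord q q v)))

/-- The Leibniz rule for fields along a map. The first term is tensorial, so identities proved for
vector fields on M pass to fields along F, which need not extend to M. -/
theorem SmoothOpAt.covAlong_apply (hT : SmoothOpAt T (F x)) (hV : SmoothAlongAt E' F V x)
    (ξ : TangentSpace 𝓘(ℝ, E') x) :
    covAlong F (fun x' => T (F x') (V x')) x ξ
      = covOp T (F x) (mfderiv 𝓘(ℝ, E') 𝓘(ℝ, E) F x ξ) (V x) + T (F x) (covAlong F V x ξ) := by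
  have hT' : MDifferentiableAt 𝓘(ℝ, E) 𝓘(ℝ, E →L[ℝ] E) (opCoord (F x) T) (F x) :=
    hT.contMDiffAt_opCoord.mdifferentiableAt (by simp)
  have hF := hV.mdifferentiableAt_base
  have hTF : MDifferentiableAt 𝓘(ℝ, E') 𝓘(ℝ, E →L[ℝ] E) (fun x' => opCoord (F x) T (F x')) x :=
    hT'.comp x hF
  have h1 : mvfderiv 𝓘(ℝ, E') (fun x' => toCoord (F x) (F x') (T (F x') (V x'))) x ξ
      = mvfderiv 𝓘(ℝ, E) (opCoord (F x) T) (F x) (mfderiv 𝓘(ℝ, E') 𝓘(ℝ, E) F x ξ)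
          (toCoord (F x) (F x) (V x))
        + opCoord (F x) T (F x)
          (mvfderiv 𝓘(ℝ, E') (fun x' => toCoord (F x) (F x') (V x')) x ξ) := by
    rw [mvfderiv_congr (eventually_opCoord hV),
      mvfderiv_clm_apply hTF hV.mdifferentiableAt_coord, mvfderiv_comp_mfderiv hT' hF]
  unfold covOp covAlong covAlongIn
  rw [h1]
  simp only [map_add]
  have h2 : ofCoord (F x) (F x) (opCoord (F x) T (F x)
      (mvfderiv 𝓘(ℝ, E') (fun x' => toCoord (F x) (F x') (V x')) x ξ))
      = T (F x) (ofCoord (F x) (F x)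
        (mvfderiv 𝓘(ℝ, E') (fun x' => toCoord (F x) (F x') (V x')) x ξ)) :=
    ofCoord_self_toCoord _ _
  rw [h2]
  abel

theorem leviCivita_smoothOp {q : M} (hT : SmoothOpAt T q) {Z : ∀ x : M, TangentSpace 𝓘(ℝ, E) x}
    (hZ : SmoothAlongAt E (fun y : M => y) Z q) (w : TangentSpace 𝓘(ℝ, E) q) :
    leviCivita (fun y => T y (Z y)) q w = covOp T q w (Z q) + T q (leviCivita Z q w) := by
  have h := SmoothOpAt.covAlong_apply (F := fun y : M => y) hT hZ w
  rwa [show mfderiv 𝓘(ℝ, E) 𝓘(ℝ, E) (fun y : M => y) q w = w from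
    DFunLike.congr_fun (mfderiv_id (I := 𝓘(ℝ, E)) (x := q)) w] at h

end Tensor

/-! ### Smoothness tested by inner products. -/

section InnerSmooth

variable {E : Type*} [NormedAddCommGroup E] [NormedSpace ℝ E] [FiniteDimensional ℝ E]
  {M : Type*} [TopologicalSpace M] [ChartedSpace E M] [IsManifold 𝓘(ℝ, E) ∞ M]
  [RiemannianBundle (fun x : M => TangentSpace 𝓘(ℝ, E) x)]
  [IsContMDiffRiemannianBundle 𝓘(ℝ, E) ∞ E (fun x : M => TangentSpace 𝓘(ℝ, E) x)]
  {E' : Type*} [NormedAddCommGroup E'] [NormedSpace ℝ E']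
  {N : Type*} [TopologicalSpace N] [ChartedSpace E' N]
  {F : N → M} {V : ∀ x : N, TangentSpace 𝓘(ℝ, E) (F x)} {x : N}

/-- Products with the coordinate fields are the components with lowered index; the smooth inverse of
the metric matrix raises it again. -/
theorem smoothAlongAt_of_inner (hF : ContMDiffAt 𝓘(ℝ, E') 𝓘(ℝ, E) ∞ F x)
    (h : ∀ e : E, ContMDiffAt 𝓘(ℝ, E') 𝓘(ℝ, ℝ) ∞
      (fun x' => inner ℝ (V x') (ofCoord (F x) (F x') e)) x) :
    SmoothAlongAt E' F V x := by
  rw [smoothAlongAt_iff_self]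
  refine ⟨hF, ?_⟩
  have hy : extChartAt 𝓘(ℝ, E) (F x) (F x) ∈ (extChartAt 𝓘(ℝ, E) (F x)).target :=
    mem_extChartAt_target (F x)
  let A : N → E →L[ℝ] ℝ := fun x' =>
    metricCoord (F x) (extChartAt 𝓘(ℝ, E) (F x) (F x')) (toCoord (F x) (F x') (V x'))
  have hsrc := hF.continuousAt.eventually_mem (chart_source_mem_nhds E (F x))
  have hA : ContMDiffAt 𝓘(ℝ, E') 𝓘(ℝ, E →L[ℝ] ℝ) ∞ A x := by
    refine contMDiffAt_clm_of_apply fun e => (h e).congr_of_eventuallyEq ?_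
    filter_upwards [hsrc] with x' hx'
    rw [inner_eq_metricCoord hx', toCoord_ofCoord hx']
  have hchart : ContMDiffAt 𝓘(ℝ, E') 𝓘(ℝ, E) ∞
      (fun x' => extChartAt 𝓘(ℝ, E) (F x) (F x')) x :=
    (contMDiffAt_extChartAt (I := 𝓘(ℝ, E)) (x := F x)).comp x hF
  have hinv : ContMDiffAt 𝓘(ℝ, E') 𝓘(ℝ, (E →L[ℝ] ℝ) →L[ℝ] E) ∞
      (fun x' => (metricCoord (F x) (extChartAt 𝓘(ℝ, E) (F x) (F x'))).inverse) x := by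
    have h1 : ContDiffAt ℝ ∞ (fun y => (metricCoord (E := E) (F x) y).inverse)
        (extChartAt 𝓘(ℝ, E) (F x) (F x)) := by
      obtain ⟨e, he⟩ := isInvertible_metricCoord hy
      have h2 : ContDiffAt ℝ ∞ (ContinuousLinearMap.inverse : (E →L[ℝ] E →L[ℝ] ℝ) → _)
          (metricCoord (F x) (extChartAt 𝓘(ℝ, E) (F x) (F x))) := he ▸ contDiffAt_map_inverse e
      exact h2.comp _ ((contDiffOn_metricCoord (F x)).contDiffAt
        ((isOpen_extChartAt_target (F x)).mem_nhds hy))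
    exact ContMDiffAt.comp x (g := fun y => (metricCoord (E := E) (F x) y).inverse)
      h1.contMDiffAt hchart
  refine (hinv.clm_apply hA).congr_of_eventuallyEq ?_
  filter_upwards [hsrc] with x' hx'
  have hx'' : F x' ∈ (extChartAt 𝓘(ℝ, E) (F x)).source := by rwa [extChartAt_source]
  exact ((isInvertible_metricCoord
    ((extChartAt 𝓘(ℝ, E) (F x)).map_source hx'')).inverse_apply_eq.2 rfl).symm

end InnerSmooth

/-! ### The parallel complex structure along maps. -/

section Kahler

variable {E : Type*} [NormedAddCommGroup E] [NormedSpace ℝ E] [FiniteDimensional ℝ E]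
  {M : Type*} [TopologicalSpace M] [T2Space M] [ChartedSpace E M] [IsManifold 𝓘(ℝ, E) ∞ M]
  [RiemannianBundle (fun x : M => TangentSpace 𝓘(ℝ, E) x)]
  {J : ∀ q : M, TangentSpace 𝓘(ℝ, E) q →L[ℝ] TangentSpace 𝓘(ℝ, E) q}
  {E' : Type*} [NormedAddCommGroup E'] [NormedSpace ℝ E']
  {N : Type*} [TopologicalSpace N] [ChartedSpace E' N]
  {F : N → M} {V : ∀ x : N, TangentSpace 𝓘(ℝ, E) (F x)} {x : N}

omit [T2Space M] [FiniteDimensional ℝ E] in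
theorem IsKahler.smoothOpAt (hJ : IsKahler J) (q : M) : SmoothOpAt J q := by
  intro Z hZ
  exact ContMDiffAt.clm_bundle_apply (F₁ := E) (E₁ := fun x : M => TangentSpace 𝓘(ℝ, E) x)
    (F₂ := E) (E₂ := fun x : M => TangentSpace 𝓘(ℝ, E) x) (b := fun y : M => y)
    (hJ.smooth q) (hZ.smoothAlongAt Filter.univ_mem)

/-- Parallelism is assumed for global fields only, but every tangent vector is a value of one. -/
theorem IsKahler.covOp_eq_zero (hJ : IsKahler J) (q : M) (w v : TangentSpace 𝓘(ℝ, E) q) :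
    covOp J q w v = 0 := by
  obtain ⟨Z, hZ, rfl⟩ := exists_smooth_extension_vector q v
  have h := leviCivita_smoothOp (hJ.smoothOpAt q) (hZ.smoothAlongAt Filter.univ_mem) w
  rw [hJ.parallel Z hZ q w] at h
  simpa using h

theorem IsKahler.smoothAlongAt (hJ : IsKahler J) (hV : SmoothAlongAt E' F V x) :
    SmoothAlongAt E' F (fun x' => J (F x') (V x')) x :=
  (hJ.smoothOpAt (F x)).apply hV

theorem IsKahler.covAlong (hJ : IsKahler J) (hV : SmoothAlongAt E' F V x)
    (ξ : TangentSpace 𝓘(ℝ, E') x) :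
    covAlong F (fun x' => J (F x') (V x')) x ξ = J (F x) (covAlong F V x ξ) := by
  rw [(hJ.smoothOpAt (F x)).covAlong_apply hV, hJ.covOp_eq_zero, zero_add]

end Kahler

/-! ### The second fundamental form as a symmetric tensor. -/

section SecondFundamentalForm

variable {E : Type*} [NormedAddCommGroup E] [NormedSpace ℝ E]
  {P : Type*} [TopologicalSpace P] [ChartedSpace E P] [IsManifold 𝓘(ℝ, E) ∞ P]
  {E' : Type*} [NormedAddCommGroup E'] [NormedSpace ℝ E']
  {Q : Type*} [TopologicalSpace Q] [ChartedSpace E' Q] [IsManifold 𝓘(ℝ, E') ∞ Q]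

/-- The map `Φ` read in the charts centred at `p` and at `Φ p`. -/
def mapCoord (E E' : Type*) [NormedAddCommGroup E] [NormedSpace ℝ E]
    {P : Type*} [TopologicalSpace P] [ChartedSpace E P]
    [NormedAddCommGroup E'] [NormedSpace ℝ E']
    {Q : Type*} [TopologicalSpace Q] [ChartedSpace E' Q] (Φ : P → Q) (p : P) (z : E) : E' :=
  extChartAt 𝓘(ℝ, E') (Φ p) (Φ ((extChartAt 𝓘(ℝ, E) p).symm z))

variable {Φ : P → Q} (hΦ : ContMDiff 𝓘(ℝ, E) 𝓘(ℝ, E') ∞ Φ) (p : P)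

include hΦ in
theorem contDiffAt_mapCoord {p' : P} (hp : p' ∈ (chartAt E p).source)
    (hq : Φ p' ∈ (chartAt E' (Φ p)).source) :
    ContDiffAt ℝ ∞ (mapCoord E E' Φ p) (extChartAt 𝓘(ℝ, E) p p') := by
  have hp' : p' ∈ (extChartAt 𝓘(ℝ, E) p).source := by rwa [extChartAt_source]
  rw [← contMDiffAt_iff_contDiffAt]
  have h1 : ContMDiffAt 𝓘(ℝ, E) 𝓘(ℝ, E) ∞ (extChartAt 𝓘(ℝ, E) p).symm
      (extChartAt 𝓘(ℝ, E) p p') :=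
    (contMDiffOn_extChartAt_symm p).contMDiffAt
      ((isOpen_extChartAt_target p).mem_nhds ((extChartAt 𝓘(ℝ, E) p).map_source hp'))
  have h2 : ContMDiffAt 𝓘(ℝ, E) 𝓘(ℝ, E') ∞ (fun x => extChartAt 𝓘(ℝ, E') (Φ p) (Φ x))
      ((extChartAt 𝓘(ℝ, E) p).symm (extChartAt 𝓘(ℝ, E) p p')) := by
    rw [(extChartAt 𝓘(ℝ, E) p).left_inv hp']
    exact (contMDiffAt_extChartAt' hq).comp p' (hΦ p')
  exact h2.comp _ h1

include hΦ in
theorem toCoord_mfderiv {p' : P} (hp : p' ∈ (chartAt E p).source)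
    (hq : Φ p' ∈ (chartAt E' (Φ p)).source) (v : TangentSpace 𝓘(ℝ, E) p') :
    toCoord (Φ p) (Φ p') (mfderiv 𝓘(ℝ, E) 𝓘(ℝ, E') Φ p' v)
      = fderiv ℝ (mapCoord E E' Φ p) (extChartAt 𝓘(ℝ, E) p p') (toCoord p p' v) := by
  have hd : MDifferentiableAt 𝓘(ℝ, E) 𝓘(ℝ, E') Φ p' := (hΦ p').mdifferentiableAt (by simp)
  have hid : MDifferentiableAt 𝓘(ℝ, E) 𝓘(ℝ, E) (extChartAt 𝓘(ℝ, E) p) p' :=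
    mdifferentiableAt_extChartAt hp
  rw [← mvfderiv_chart hd hq]
  have hev : (fun x' => extChartAt 𝓘(ℝ, E') (Φ p) (Φ x')) =ᶠ[𝓝 p'] fun x' =>
      mapCoord E E' Φ p (extChartAt 𝓘(ℝ, E) p x') := by
    filter_upwards [(chartAt E p).open_source.mem_nhds hp] with x' hx'
    have hx'' : x' ∈ (extChartAt 𝓘(ℝ, E) p).source := by rwa [extChartAt_source]
    rw [mapCoord, (extChartAt 𝓘(ℝ, E) p).left_inv hx'']
  rw [mvfderiv_congr hev, mvfderiv_comp_fderiv
    ((contDiffAt_mapCoord hΦ p hp hq).differentiableAt (by simp)) hid, toCoord_eq_mfderiv hp]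
  rfl

variable [RiemannianBundle (fun x : P => TangentSpace 𝓘(ℝ, E) x)]
  [RiemannianBundle (fun x : Q => TangentSpace 𝓘(ℝ, E') x)]

/-- The second fundamental form of `Φ` at `p` as a bilinear map on the tangent space. -/
def sff (Φ : P → Q) (p : P) (x y : TangentSpace 𝓘(ℝ, E) p) : TangentSpace 𝓘(ℝ, E') (Φ p) :=
  ofCoord (Φ p) (Φ p)
    (fderiv ℝ (fderiv ℝ (mapCoord E E' Φ p)) (extChartAt 𝓘(ℝ, E) p p) (toCoord p p x)
        (toCoord p p y)
      + christoffel (Φ p) (extChartAt 𝓘(ℝ, E') (Φ p) (Φ p))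
          (toCoord (Φ p) (Φ p) (mfderiv 𝓘(ℝ, E) 𝓘(ℝ, E') Φ p x))
          (toCoord (Φ p) (Φ p) (mfderiv 𝓘(ℝ, E) 𝓘(ℝ, E') Φ p y)))
    - mfderiv 𝓘(ℝ, E) 𝓘(ℝ, E') Φ p (ofCoord p p
      (christoffel p (extChartAt 𝓘(ℝ, E) p p) (toCoord p p x) (toCoord p p y)))

theorem sff_add_left (x x' y : TangentSpace 𝓘(ℝ, E) p) :
    sff (E' := E') Φ p (x + x') y = sff Φ p x y + sff Φ p x' y := by
  simp only [sff, map_add, add_apply, christoffel_add_left]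
  abel

theorem sff_add_right (x y y' : TangentSpace 𝓘(ℝ, E) p) :
    sff (E' := E') Φ p x (y + y') = sff Φ p x y + sff Φ p x y' := by
  simp only [sff, map_add, christoffel_add_right]
  abel

-- The derivative of the components of Y occurs in both terms of the definition, each time mapped by
-- the differential of Φ, and cancels.
include hΦ in
theorem secondFundamentalForm_eq_sff (X : ∀ p : P, TangentSpace 𝓘(ℝ, E) p)
    {Y : ∀ p : P, TangentSpace 𝓘(ℝ, E) p} (hY : SmoothAlongAt E (fun y : P => y) Y p) :
    secondFundamentalForm E E' Φ X Y p = sff Φ p (X p) (Y p) := by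
  have hsrc := mem_chart_source E p
  have hqsrc := mem_chart_source E' (Φ p)
  have hφ := contDiffAt_mapCoord hΦ p hsrc hqsrc
  have hcont : ContinuousAt Φ p := (hΦ p).continuousAt
  have hev : (fun x' => toCoord (Φ p) (Φ x') (push E E' Φ x' (Y x'))) =ᶠ[𝓝 p] fun x' =>
      fderiv ℝ (mapCoord E E' Φ p) (extChartAt 𝓘(ℝ, E) p x') (toCoord p x' (Y x')) := by
    filter_upwards [chart_source_mem_nhds E p,
      hcont.eventually_mem (chart_source_mem_nhds E' (Φ p))] with x' hx' hx''
    exact toCoord_mfderiv hΦ p hx' hx'' (Y x')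
  have hchart : MDifferentiableAt 𝓘(ℝ, E) 𝓘(ℝ, E) (fun x' => extChartAt 𝓘(ℝ, E) p x') p :=
    mdifferentiableAt_extChartAt hsrc
  have hdd : DifferentiableAt ℝ (fderiv ℝ (mapCoord E E' Φ p)) (extChartAt 𝓘(ℝ, E) p p) :=
    (hφ.fderiv_right (m := 1) (by norm_cast)).differentiableAt (by simp)
  have hA : MDifferentiableAt 𝓘(ℝ, E) 𝓘(ℝ, E →L[ℝ] E')
      (fun x' => fderiv ℝ (mapCoord E E' Φ p) (extChartAt 𝓘(ℝ, E) p x')) p :=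
    MDifferentiableAt.comp (g := fderiv ℝ (mapCoord E E' Φ p)) p hdd.mdifferentiableAt hchart
  have hX : mvfderiv 𝓘(ℝ, E) (fun x' => extChartAt 𝓘(ℝ, E) p x') p (X p)
      = toCoord p p (X p) := by
    rw [toCoord_eq_mfderiv hsrc]
    rfl
  have h1 : mvfderiv 𝓘(ℝ, E) (fun x' => toCoord (Φ p) (Φ x') (push E E' Φ x' (Y x'))) p (X p)
      = fderiv ℝ (fderiv ℝ (mapCoord E E' Φ p)) (extChartAt 𝓘(ℝ, E) p p) (toCoord p p (X p))
          (toCoord p p (Y p))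
        + fderiv ℝ (mapCoord E E' Φ p) (extChartAt 𝓘(ℝ, E) p p)
          (mvfderiv 𝓘(ℝ, E) (fun x' => toCoord p x' (Y x')) p (X p)) := by
    rw [mvfderiv_congr hev, mvfderiv_clm_apply hA hY.mdifferentiableAt_coord,
      mvfderiv_comp_fderiv (g := fderiv ℝ (mapCoord E E' Φ p)) hdd hchart, hX]
  have h2 : ∀ e : E, fderiv ℝ (mapCoord E E' Φ p) (extChartAt 𝓘(ℝ, E) p p) e
      = toCoord (Φ p) (Φ p) (mfderiv 𝓘(ℝ, E) 𝓘(ℝ, E') Φ p (ofCoord p p e)) := by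
    intro e
    rw [toCoord_mfderiv hΦ p hsrc hqsrc, toCoord_self_ofCoord]
  have h3 : mfderiv 𝓘(ℝ, E) 𝓘(ℝ, E) (fun y : P => y) p (X p) = X p :=
    DFunLike.congr_fun (mfderiv_id (I := 𝓘(ℝ, E)) (x := p)) (X p)
  unfold secondFundamentalForm leviCivita covAlong covAlongIn sff
  rw [h1, h2, h3]
  simp only [map_add, ofCoord_self_toCoord]
  unfold push
  abel

variable [FiniteDimensional ℝ E] [FiniteDimensional ℝ E']
  [IsContMDiffRiemannianBundle 𝓘(ℝ, E) ∞ E (fun x : P => TangentSpace 𝓘(ℝ, E) x)]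
  [IsContMDiffRiemannianBundle 𝓘(ℝ, E') ∞ E' (fun x : Q => TangentSpace 𝓘(ℝ, E') x)]

-- Second derivatives commute, and both Levi-Civita connections are torsion-free.
include hΦ in
theorem sff_symm (x y : TangentSpace 𝓘(ℝ, E) p) : sff (E' := E') Φ p x y = sff Φ p y x := by
  have hφ := contDiffAt_mapCoord hΦ p (mem_chart_source E p) (mem_chart_source E' (Φ p))
  have h : IsSymmSndFDerivAt ℝ (mapCoord E E' Φ p) (extChartAt 𝓘(ℝ, E) p p) :=
    hφ.isSymmSndFDerivAt (by simp only [minSmoothness_of_isRCLikeNormedField]; exact WithTop.coe_le_coe.2 le_top)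
  unfold sff
  rw [h.eq, christoffel_symm (mem_extChartAt_target (Φ p)),
    christoffel_symm (mem_extChartAt_target p)]

end SecondFundamentalForm

/-! ### Local existence of geodesics. -/

section Geodesics

variable {E : Type*} [NormedAddCommGroup E] [NormedSpace ℝ E] [FiniteDimensional ℝ E]
  {M : Type*} [TopologicalSpace M] [ChartedSpace E M] [IsManifold 𝓘(ℝ, E) ∞ M]
  [RiemannianBundle (fun x : M => TangentSpace 𝓘(ℝ, E) x)]
  [IsContMDiffRiemannianBundle 𝓘(ℝ, E) ∞ E (fun x : M => TangentSpace 𝓘(ℝ, E) x)]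

theorem mvfderiv_real {G : Type*} [NormedAddCommGroup G] [NormedSpace ℝ G] (f : ℝ → G) (t : ℝ) :
    mvfderiv 𝓘(ℝ, ℝ) f t (1 : ℝ) = deriv f t := by
  unfold mvfderiv
  rw [mfderiv_eq_fderiv]
  rfl

/-- Solutions of the geodesic equation in the chart centred at `q`. -/
theorem exists_coord_geodesic (q : M) (v : E) {U : Set E} (hU : U ∈ 𝓝 (extChartAt 𝓘(ℝ, E) q q)) :
    ∃ ε > 0, ∃ α : ℝ → E × E, α 0 = (extChartAt 𝓘(ℝ, E) q q, v) ∧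
      ContDiffOn ℝ ∞ α (Set.Ioo (-ε) ε) ∧
      ∀ t ∈ Set.Ioo (-ε) ε, (α t).1 ∈ U ∧
        HasDerivAt α ((α t).2, -christoffel q (α t).1 (α t).2 (α t).2) t := by
  let s : Set E := (extChartAt 𝓘(ℝ, E) q).target
  have hs : IsOpen s := isOpen_extChartAt_target q
  have hqs : extChartAt 𝓘(ℝ, E) q q ∈ s := mem_extChartAt_target q
  let X : E × E → E × E := fun z => (z.2, -christoffel q z.1 z.2 z.2)
  have hX : ContDiffOn ℝ ∞ X (s ×ˢ Set.univ) :=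
    contDiffOn_snd.prodMk (contDiffOn_christoffel q).neg
  have hX1 : ContDiffAt ℝ 1 X (extChartAt 𝓘(ℝ, E) q q, v) :=
    (hX.contDiffAt ((hs.prod isOpen_univ).mem_nhds ⟨hqs, trivial⟩)).of_le (by norm_cast)
  obtain ⟨α, hα0, ε₀, hε₀, hα⟩ :=
    hX1.exists_forall_mem_closedBall_exists_eq_forall_mem_Ioo_hasDerivAt₀ 0
  have hcont : ContinuousAt α 0 := (hα 0 ⟨by linarith, by linarith⟩).continuousAt
  have hmem : ∀ᶠ t in 𝓝 (0 : ℝ), (α t).1 ∈ s ∩ U := by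
    refine hcont.fst.eventually_mem ?_
    rw [hα0]
    exact Filter.inter_mem (hs.mem_nhds hqs) hU
  obtain ⟨ε₁, hε₁, h₁⟩ := Metric.eventually_nhds_iff.1 hmem
  -- Halving makes the closed interval fit inside the open ones on which the solution exists and
  -- stays in the chart; the regularity theorem for solutions is stated on closed intervals.
  have hε : 0 < min ε₀ ε₁ / 2 := by positivity
  have hle₀ := min_le_left ε₀ ε₁
  have hle₁ := min_le_right ε₀ ε₁
  have hI : ∀ t ∈ Set.Icc (-(min ε₀ ε₁ / 2)) (min ε₀ ε₁ / 2),
      (α t).1 ∈ s ∩ U ∧ HasDerivAt α (X (α t)) t := by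
    intro t ht
    refine ⟨h₁ ?_, hα t ⟨by linarith [ht.1], by linarith [ht.2]⟩⟩
    rw [Real.dist_eq, sub_zero, abs_lt]
    exact ⟨by linarith [ht.1], by linarith [ht.2]⟩
  refine ⟨min ε₀ ε₁ / 2, hε, α, hα0, ?_, fun t ht => ?_⟩
  · have hsm : ContDiffOn ℝ ∞ α (Set.Icc (-(min ε₀ ε₁ / 2)) (min ε₀ ε₁ / 2)) := by
      refine ODE.contDiffOn_enat_Icc_of_hasDerivWithinAt (n := ⊤) (f := fun _ z => X z)
        (u := s ×ˢ Set.univ) ?_ (fun t ht => (hI t ht).2.hasDerivWithinAt)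
        fun t ht => ⟨(hI t ht).1.1, trivial⟩
      exact hX.comp contDiffOn_snd fun z hz => hz.2
    exact hsm.mono Set.Ioo_subset_Icc_self
  · obtain ⟨h, h'⟩ := hI t (Set.Ioo_subset_Icc_self ht)
    exact ⟨h.2, h'⟩

/-- Local existence of geodesics. -/
theorem exists_geodesic (q : M) (v : TangentSpace 𝓘(ℝ, E) q) {V : Set M} (hV : V ∈ 𝓝 q) :
    ∃ ε > 0, ∃ η : ℝ → M, η 0 = q ∧ toCoord q (η 0) (velocity E η 0) = toCoord q q v ∧
      SmoothAlongAt ℝ η (velocity E η) 0 ∧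
      covAlongIn (E' := ℝ) q η (velocity E η) 0 (1 : ℝ) = 0 ∧
      IsGeodesicOn E η (Set.Ioo (-ε) ε) ∧ Set.MapsTo η (Set.Ioo (-ε) ε) V := by
  have hsymm : ContinuousAt (extChartAt 𝓘(ℝ, E) q).symm (extChartAt 𝓘(ℝ, E) q q) :=
    continuousAt_extChartAt_symm q
  have hU : (extChartAt 𝓘(ℝ, E) q).target ∩ (extChartAt 𝓘(ℝ, E) q).symm ⁻¹' V
      ∈ 𝓝 (extChartAt 𝓘(ℝ, E) q q) := by
    refine Filter.inter_mem (extChartAt_target_mem_nhds q) (hsymm ?_)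
    rwa [extChartAt_to_inv]
  obtain ⟨ε, hε, α, hα0, hαs, hα⟩ := exists_coord_geodesic q (toCoord q q v) hU
  let η : ℝ → M := fun t => (extChartAt 𝓘(ℝ, E) q).symm (α t).1
  have h0 : (0 : ℝ) ∈ Set.Ioo (-ε) ε := ⟨by linarith, hε⟩
  have hη0 : η 0 = q := by
    change (extChartAt 𝓘(ℝ, E) q).symm (α 0).1 = q
    rw [hα0, extChartAt_to_inv]
  have hsrc : ∀ t ∈ Set.Ioo (-ε) ε, η t ∈ (chartAt E q).source := fun t ht =>
    extChartAt_symm_mem (hα t ht).1.1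
  have hchart : ∀ t ∈ Set.Ioo (-ε) ε, extChartAt 𝓘(ℝ, E) q (η t) = (α t).1 := fun t ht =>
    (extChartAt 𝓘(ℝ, E) q).right_inv (hα t ht).1.1
  have hαat : ∀ t ∈ Set.Ioo (-ε) ε, ContDiffAt ℝ ∞ α t := fun t ht =>
    hαs.contDiffAt (isOpen_Ioo.mem_nhds ht)
  have hηat : ∀ t ∈ Set.Ioo (-ε) ε, ContMDiffAt 𝓘(ℝ, ℝ) 𝓘(ℝ, E) ∞ η t := fun t ht =>
    ((contMDiffOn_extChartAt_symm q).contMDiffAt ((isOpen_extChartAt_target q).mem_nhds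
      (hα t ht).1.1)).comp t (hαat t ht).fst.contMDiffAt
  have hvel : ∀ t ∈ Set.Ioo (-ε) ε, toCoord q (η t) (velocity E η t) = (α t).2 := by
    intro t ht
    refine (mvfderiv_chart ((hηat t ht).mdifferentiableAt (by simp)) (hsrc t ht) (1 : ℝ)).symm.trans
      ((mvfderiv_real _ t).trans ?_)
    have hd : HasDerivAt (fun t => (α t).1) (α t).2 t := (hα t ht).2.fst
    rw [← hd.deriv]
    refine Filter.EventuallyEq.deriv_eq ?_
    filter_upwards [isOpen_Ioo.mem_nhds ht] with t' ht'
    exact hchart t' ht'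
  have hveleq : ∀ t ∈ Set.Ioo (-ε) ε,
      (fun t' => toCoord q (η t') (velocity E η t')) =ᶠ[𝓝 t] fun t' => (α t').2 := by
    intro t ht
    filter_upwards [isOpen_Ioo.mem_nhds ht] with t' ht'
    exact hvel t' ht'
  have hgeo : ∀ t ∈ Set.Ioo (-ε) ε,
      covAlongIn (E' := ℝ) q η (velocity E η) t (1 : ℝ) = 0 := by
    intro t ht
    have hd : HasDerivAt (fun t => (α t).2) (-christoffel q (α t).1 (α t).2 (α t).2) t :=
      (hα t ht).2.snd
    have hv : toCoord q (η t) (mfderiv 𝓘(ℝ, ℝ) 𝓘(ℝ, E) η t (1 : ℝ)) = (α t).2 := hvel t ht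
    have h1 : mvfderiv 𝓘(ℝ, ℝ) (fun t' => toCoord q (η t') (velocity E η t')) t (1 : ℝ)
        = -christoffel q (α t).1 (α t).2 (α t).2 :=
      (mvfderiv_congr (hveleq t ht) (1 : ℝ)).trans ((mvfderiv_real _ t).trans hd.deriv)
    have h2 := congr (congr (congrArg (christoffel q) (hchart t ht)) hv) (hvel t ht)
    exact (congrArg (ofCoord q (η t)) ((congrArg₂ (· + ·) h1 h2).trans (neg_add_cancel _))).trans
      (map_zero _)
  refine ⟨ε, hε, η, hη0, ?_, ?_, hgeo 0 h0, ⟨fun t ht => (hηat t ht).contMDiffWithinAt,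
    fun t ht => ⟨q, ?_, hgeo t ht⟩⟩, fun t ht => (hα t ht).1.2⟩
  · rw [hvel 0 h0, hα0]
  · rw [smoothAlongAt_iff (hsrc 0 h0)]
    exact ⟨hηat 0 h0, ((hαat 0 h0).snd.contMDiffAt).congr_of_eventuallyEq (hveleq 0 h0)⟩
  · rw [extChartAt_source]
    exact hsrc t ht

end Geodesics

/-! ### Algebra of the covariant derivative of an orthogonal projection. -/

section Projection

variable {E : Type*} [NormedAddCommGroup E] [NormedSpace ℝ E] [FiniteDimensional ℝ E]
  {M : Type*} [TopologicalSpace M] [T2Space M] [ChartedSpace E M] [IsManifold 𝓘(ℝ, E) ∞ M]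
  [RiemannianBundle (fun x : M => TangentSpace 𝓘(ℝ, E) x)]
  {D : ∀ q : M, Submodule ℝ (TangentSpace 𝓘(ℝ, E) q)}

/-- Orthogonal projection onto the distribution `D`. -/
def projOp (D : ∀ q : M, Submodule ℝ (TangentSpace 𝓘(ℝ, E) q)) (q : M) :
    TangentSpace 𝓘(ℝ, E) q →L[ℝ] TangentSpace 𝓘(ℝ, E) q :=
  (D q).starProjection

omit [T2Space M] in
theorem IsSmoothDistributionOn.smoothOpAt {s : Set M} (hD : IsSmoothDistributionOn D s) {q : M}
    (hs : s ∈ 𝓝 q) : SmoothOpAt (projOp D) q := fun Z hZ =>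
  (hD Z (ContMDiffOn.mono hZ (Set.subset_univ s))).smoothAlongAt hs

variable {T : ∀ q : M, TangentSpace 𝓘(ℝ, E) q →L[ℝ] TangentSpace 𝓘(ℝ, E) q}

omit [FiniteDimensional ℝ E] [T2Space M] in
theorem covOp_add_left (q : M) (w w' v : TangentSpace 𝓘(ℝ, E) q) :
    covOp T q (w + w') v = covOp T q w v + covOp T q w' v := by
  simp only [covOp, map_add, add_apply, christoffel_add_left]
  abel

omit [FiniteDimensional ℝ E] [T2Space M] in
theorem covOp_add_right (q : M) (w v v' : TangentSpace 𝓘(ℝ, E) q) :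
    covOp T q w (v + v') = covOp T q w v + covOp T q w v' := by
  simp only [covOp, map_add, christoffel_add_right]
  abel

/-- Obtained by differentiating T(TZ) = TZ. It says that ∇T exchanges the range and the kernel of T.
-/
theorem covOp_idempotent {q : M} (hT : SmoothOpAt T q) (h : ∀ q v, T q (T q v) = T q v)
    (w v : TangentSpace 𝓘(ℝ, E) q) :
    covOp T q w v = covOp T q w (T q v) + T q (covOp T q w v) := by
  obtain ⟨Z, hZ, rfl⟩ := exists_smooth_extension_vector q v
  have hZq := hZ.smoothAlongAt (x := q) Filter.univ_mem
  have h1 := leviCivita_smoothOp hT (SmoothOpAt.apply (F := fun y : M => y) hT hZq) w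
  simp only [h] at h1
  rw [leviCivita_smoothOp hT hZq w, map_add, h] at h1
  have h2 := add_right_cancel (h1.trans (add_assoc _ _ _).symm)
  exact h2

/-- Obtained by differentiating ⟨TZ,Z'⟩ = ⟨Z,TZ'⟩ with metric compatibility. -/
theorem covOp_symm [IsContMDiffRiemannianBundle 𝓘(ℝ, E) ∞ E (fun x : M => TangentSpace 𝓘(ℝ, E) x)]
    {q : M} (hT : SmoothOpAt T q) (h : ∀ q v w, inner ℝ (T q v) w = inner ℝ v (T q w))
    (w v v' : TangentSpace 𝓘(ℝ, E) q) :
    inner ℝ (covOp T q w v) v' = inner ℝ v (covOp T q w v') := by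
  obtain ⟨Z, hZ, rfl⟩ := exists_smooth_extension_vector q v
  obtain ⟨Z', hZ', rfl⟩ := exists_smooth_extension_vector q v'
  have hZq := hZ.smoothAlongAt (x := q) Filter.univ_mem
  have hZq' := hZ'.smoothAlongAt (x := q) Filter.univ_mem
  have h1 := mvfderiv_inner (SmoothOpAt.apply (F := fun y : M => y) hT hZq) hZq' w
  have h2 := mvfderiv_inner hZq (SmoothOpAt.apply (F := fun y : M => y) hT hZq') w
  simp only [h] at h1
  rw [h2] at h1
  have h3 := leviCivita_smoothOp hT hZq w
  have h4 := leviCivita_smoothOp hT hZq' w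
  unfold leviCivita at h3 h4
  rw [h3, h4, inner_add_right, inner_add_left, h] at h1
  linarith

end Projection

/-- Both sides equal |v|² minus the squared length of the component of v in the complement of K.
This removes the angle from the Clairaut relation, also when v or that component is zero. -/
theorem sin_angle_orthogonal_starProjection {F : Type*} [NormedAddCommGroup F]
    [InnerProductSpace ℝ F] (K : Submodule ℝ F) [K.HasOrthogonalProjection] (v : F) :
    Real.sin (InnerProductGeometry.angle v (Kᗮ.starProjection v)) ^ 2 * inner ℝ v v
      = inner ℝ (K.starProjection v) v := by
  have hsum : K.starProjection v + Kᗮ.starProjection v = v :=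
    K.starProjection_add_starProjection_orthogonal v
  have hKv : inner ℝ (K.starProjection v) v = inner ℝ v v - inner ℝ v (Kᗮ.starProjection v) := by
    rw [← inner_sub_right, ← eq_sub_of_add_eq hsum, real_inner_comm]
  have hu : inner ℝ v (Kᗮ.starProjection v) = ‖Kᗮ.starProjection v‖ ^ 2 := by
    have h : inner ℝ (K.starProjection v) (Kᗮ.starProjection v) = 0 :=
      Submodule.inner_right_of_mem_orthogonal (K.starProjection_apply_mem v)
        (Kᗮ.starProjection_apply_mem v)
    rw [eq_sub_of_add_eq hsum, inner_sub_left, sub_eq_zero] at h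
    rw [← real_inner_self_eq_norm_sq, h]
  by_cases h0 : v = 0
  · simp [h0]
  have hv : ‖v‖ ≠ 0 := norm_ne_zero_iff.2 h0
  rw [hKv, hu, Real.sin_sq, InnerProductGeometry.cos_angle, hu, real_inner_self_eq_norm_sq]
  by_cases hu0 : ‖Kᗮ.starProjection v‖ = 0
  · rw [hu0]
    simp
  · field_simp

/-! ### From the Clairaut relation to the derivative of the projection. -/

section Clairaut

variable {E : Type*} [NormedAddCommGroup E] [NormedSpace ℝ E] [FiniteDimensional ℝ E]
  {M : Type*} [TopologicalSpace M] [T2Space M] [ChartedSpace E M] [IsManifold 𝓘(ℝ, E) ∞ M]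
  [RiemannianBundle (fun x : M => TangentSpace 𝓘(ℝ, E) x)]
  [IsContMDiffRiemannianBundle 𝓘(ℝ, E) ∞ E (fun x : M => TangentSpace 𝓘(ℝ, E) x)]
  {D : ∀ q : M, Submodule ℝ (TangentSpace 𝓘(ℝ, E) q)}

omit [T2Space M] in
theorem hasDerivAt_inner {F : ℝ → M} {V W : ∀ t : ℝ, TangentSpace 𝓘(ℝ, E) (F t)} {t : ℝ}
    (hV : SmoothAlongAt ℝ F V t) (hW : SmoothAlongAt ℝ F W t) :
    HasDerivAt (fun t => inner ℝ (V t) (W t))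
      (inner ℝ (covAlong (E' := ℝ) F V t (1 : ℝ)) (W t)
        + inner ℝ (V t) (covAlong (E' := ℝ) F W t (1 : ℝ))) t := by
  have h := mvfderiv_inner hV hW (1 : ℝ)
  have h' := (mvfderiv_real (fun t => inner ℝ (V t) (W t)) t).symm.trans h
  rw [← h']
  exact ((hV.inner hW).contDiffAt.differentiableAt (by simp)).hasDerivAt

/-- First variation of the Clairaut relation along the geodesics issuing from `q`. -/
theorem clairaut_quadratic {f : M → ℝ} (hf : ContMDiff 𝓘(ℝ, E) 𝓘(ℝ, ℝ) ∞ f) {V : Set M}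
    (hD : IsSmoothDistributionOn D V)
    (hgeo : ∀ (a b : ℝ) (η : ℝ → M), IsGeodesicOn E η (Set.Ioo a b) →
      Set.MapsTo η (Set.Ioo a b) V → ∃ k : ℝ, ∀ t ∈ Set.Ioo a b,
        Real.exp (f (η t)) * Real.sin (InnerProductGeometry.angle (velocity E η t)
          ((D (η t))ᗮ.starProjection (velocity E η t))) = k)
    {q : M} (hV : V ∈ 𝓝 q) (v : TangentSpace 𝓘(ℝ, E) q) :
    2 * mvfderiv 𝓘(ℝ, E) f q v * inner ℝ (projOp D q v) v
      + inner ℝ (covOp (projOp D) q v v) v = 0 := by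
  obtain ⟨ε, hε, η, rfl, hv, hsm, hcov, hη, hmaps⟩ := exists_geodesic q v hV
  have hvel : velocity E η 0 = v := toCoord_self_injective _ hv
  have hcov' : covAlong (E' := ℝ) η (velocity E η) 0 (1 : ℝ) = 0 := hcov
  obtain ⟨k, hk⟩ := hgeo _ _ η hη hmaps
  have hT : SmoothOpAt (projOp D) (η 0) := hD.smoothOpAt hV
  have hTs := SmoothOpAt.apply hT hsm
  have hTcov := SmoothOpAt.covAlong_apply hT hsm (1 : ℝ)
  have hfd : HasDerivAt (fun t => f (η t)) (mvfderiv 𝓘(ℝ, E) f (η 0) v) 0 := by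
    have h1 := mvfderiv_comp_mfderiv ((hf (η 0)).mdifferentiableAt (by simp))
      hsm.mdifferentiableAt_base (1 : ℝ)
    have h2 := (mvfderiv_real (fun t => f (η t)) 0).symm.trans h1
    have h3 : mfderiv 𝓘(ℝ, ℝ) 𝓘(ℝ, E) η 0 (1 : ℝ) = v := hvel
    rw [show mvfderiv 𝓘(ℝ, E) f (η 0) v = deriv (fun t => f (η t)) 0 from
      (congrArg (mvfderiv 𝓘(ℝ, E) f (η 0)) h3).symm.trans h2.symm]
    have h4 : ContMDiffAt 𝓘(ℝ, ℝ) 𝓘(ℝ, ℝ) ∞ (fun t => f (η t)) 0 :=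
      ContMDiffAt.comp 0 (hf (η 0)) hsm.base
    exact (h4.contDiffAt.differentiableAt (by simp)).hasDerivAt
  have hg := hasDerivAt_inner hTs hsm
  have hn := hasDerivAt_inner hsm hsm
  rw [hcov', inner_zero_left, inner_zero_right, add_zero] at hn
  rw [hcov', inner_zero_right, add_zero, hTcov, hcov', map_zero, add_zero] at hg
  have hw : mfderiv 𝓘(ℝ, ℝ) 𝓘(ℝ, E) η 0 (1 : ℝ) = v := hvel
  have hg' : HasDerivAt (fun t => inner ℝ (projOp D (η t) (velocity E η t)) (velocity E η t))
      (inner ℝ (covOp (projOp D) (η 0) v v) v) 0 := by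
    have : covOp (projOp D) (η 0) (mfderiv 𝓘(ℝ, ℝ) 𝓘(ℝ, E) η 0 (1 : ℝ)) (velocity E η 0)
        = covOp (projOp D) (η 0) v v := congrArg₂ (covOp (projOp D) (η 0)) hw hvel
    rw [← this]
    rw [hvel] at hg
    rw [hvel]
    exact hg
  have hleft := (hfd.exp.pow 2).mul hg'
  have hright := hn.const_mul (k ^ 2)
  -- The squared Clairaut relation, multiplied by |η'|². On the left, |η'|² has zero derivative
  -- because η is a geodesic.
  have heq : (fun t => k ^ 2 * inner ℝ (velocity E η t) (velocity E η t)) =ᶠ[𝓝 0]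
      (fun t => Real.exp (f (η t)) ^ 2
        * inner ℝ (projOp D (η t) (velocity E η t)) (velocity E η t)) := by
    filter_upwards [isOpen_Ioo.mem_nhds (show (0 : ℝ) ∈ Set.Ioo (-ε) ε from ⟨by linarith, hε⟩)]
      with t ht
    rw [← hk t ht, mul_pow, mul_assoc, sin_angle_orthogonal_starProjection]
    rfl
  have hfin := (hright.congr_of_eventuallyEq heq.symm).unique hleft
  rw [hvel] at hfin
  have hpos := Real.exp_pos (f (η 0))
  have : Real.exp (f (η 0)) ^ 2 * (2 * mvfderiv 𝓘(ℝ, E) f (η 0) v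
      * inner ℝ (projOp D (η 0) v) v + inner ℝ (covOp (projOp D) (η 0) v v) v) = 0 := by
    simp at hfin
    linear_combination -hfin
  exact (mul_eq_zero.1 this).resolve_left (by positivity)

/-- The quadratic relation is evaluated at w + u and w - u. Subtracting isolates the part odd in u
and discards df(w) and the derivative of the projection in the direction u. -/
theorem clairaut_projection {f : M → ℝ} {q : M} (hT : SmoothOpAt (projOp D) q)
    (h : ∀ v : TangentSpace 𝓘(ℝ, E) q, 2 * mvfderiv 𝓘(ℝ, E) f q v * inner ℝ (projOp D q v) v
      + inner ℝ (covOp (projOp D) q v v) v = 0)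
    {w u : TangentSpace 𝓘(ℝ, E) q} (hw : w ∈ D q) (hu : u ∈ (D q)ᗮ) :
    inner ℝ (covOp (projOp D) q w w) u = -(mvfderiv 𝓘(ℝ, E) f q u * inner ℝ w w) := by
  have hidem : ∀ (q : M) (v : TangentSpace 𝓘(ℝ, E) q),
      projOp D q (projOp D q v) = projOp D q v := fun q v =>
    Submodule.starProjection_eq_self_iff.2 ((D q).starProjection_apply_mem v)
  have hsymm : ∀ (q : M) (v w : TangentSpace 𝓘(ℝ, E) q),
      inner ℝ (projOp D q v) w = inner ℝ v (projOp D q w) := fun q v w =>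
    Submodule.inner_starProjection_left_eq_right (D q) v w
  have hTw : projOp D q w = w := Submodule.starProjection_eq_self_iff.2 hw
  have hTu : ∀ u ∈ (D q)ᗮ, projOp D q u = 0 := fun u hu =>
    (Submodule.starProjection_apply_eq_zero_iff (D q)).2 hu
  have hww : ∀ v, inner ℝ (covOp (projOp D) q v w) w = 0 := by
    intro v
    have h1 := covOp_idempotent hT hidem v w
    rw [hTw] at h1
    have h2 : projOp D q (covOp (projOp D) q v w) = 0 := by simpa using h1
    rw [← hTw, ← hsymm, hTw, h2, inner_zero_left]
  have huu : ∀ u ∈ (D q)ᗮ, ∀ v, inner ℝ (covOp (projOp D) q v u) u = 0 := by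
    intro u hu v
    have h0 : covOp (projOp D) q v (0 : TangentSpace 𝓘(ℝ, E) q) = 0 := by
      simpa using covOp_add_right (T := projOp D) q v 0 0
    have h1 := covOp_idempotent hT hidem v u
    rw [hTu u hu, h0, zero_add] at h1
    rw [h1, hsymm, hTu u hu, inner_zero_right]
  have hwu : ∀ u ∈ (D q)ᗮ, inner ℝ w u = 0 := fun u hu => hu w hw
  -- Expansion at w + u: the diagonal blocks of ∇T vanish by `hww` and `huu`, the two off-diagonal
  -- ones agree by `covOp_symm`, and a factor 2 drops out.
  have key : ∀ u ∈ (D q)ᗮ, (mvfderiv 𝓘(ℝ, E) f q w + mvfderiv 𝓘(ℝ, E) f q u) * inner ℝ w w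
      + inner ℝ (covOp (projOp D) q w w) u + inner ℝ (covOp (projOp D) q u w) u = 0 := by
    intro u hu
    have h1 := h (w + u)
    rw [map_add, map_add, hTw, hTu u hu, add_zero, inner_add_right, hwu u hu, add_zero,
      covOp_add_right, inner_add_left, inner_add_right, inner_add_right, hww, huu u hu,
      covOp_symm hT hsymm (w + u) u w, real_inner_comm (covOp (projOp D) q (w + u) w) u,
      covOp_add_left, inner_add_left] at h1
    linarith
  have hneg0 : covOp (projOp D) q (-u) w = -covOp (projOp D) q u w := by
    have h0 : covOp (projOp D) q (0 : TangentSpace 𝓘(ℝ, E) q) w = 0 := by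
      simpa using covOp_add_left (T := projOp D) q 0 0 w
    have h1 := covOp_add_left (T := projOp D) q u (-u) w
    rw [add_neg_cancel, h0] at h1
    exact (neg_eq_of_add_eq_zero_right h1.symm).symm
  have h1 := key u hu
  have h2 := key (-u) (Submodule.neg_mem _ hu)
  rw [map_neg, hneg0, inner_neg_right, inner_neg_left, inner_neg_right, neg_neg] at h2
  linarith

end Clairaut

/-! ### Skew-symmetry of J. -/

section KahlerInner

variable {E' : Type*} [NormedAddCommGroup E'] [NormedSpace ℝ E']
  {Q : Type*} [TopologicalSpace Q] [ChartedSpace E' Q] [IsManifold 𝓘(ℝ, E') ∞ Q]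
  [RiemannianBundle (fun x : Q => TangentSpace 𝓘(ℝ, E') x)]
  {J : ∀ q : Q, TangentSpace 𝓘(ℝ, E') q →L[ℝ] TangentSpace 𝓘(ℝ, E') q}

theorem IsKahler.inner_left (hJ : IsKahler J) (q : Q)
    (v w : TangentSpace 𝓘(ℝ, E') q) : inner ℝ (J q v) w = -inner ℝ v (J q w) := by
  rw [← hJ.orthogonal q (J q v) w, hJ.sq, inner_neg_left]

theorem IsKahler.inner_self (hJ : IsKahler J) (q : Q)
    (v : TangentSpace 𝓘(ℝ, E') q) : inner ℝ (J q v) v = 0 := by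
  have h := hJ.inner_left q v v
  rw [real_inner_comm] at h
  rw [real_inner_comm]
  linarith

end KahlerInner

/-! ### Riemannian maps: adjoint of the differential, projections, slant condition. -/

section RiemannianMaps

variable {E : Type*} [NormedAddCommGroup E] [NormedSpace ℝ E] [FiniteDimensional ℝ E]
  {P : Type*} [TopologicalSpace P] [ChartedSpace E P] [IsManifold 𝓘(ℝ, E) ∞ P]
  [RiemannianBundle (fun x : P => TangentSpace 𝓘(ℝ, E) x)]
  {E' : Type*} [NormedAddCommGroup E'] [NormedSpace ℝ E'] [FiniteDimensional ℝ E']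
  {Q : Type*} [TopologicalSpace Q] [ChartedSpace E' Q] [IsManifold 𝓘(ℝ, E') ∞ Q]
  [RiemannianBundle (fun x : Q => TangentSpace 𝓘(ℝ, E') x)]
  {Φ : P → Q}

variable (E E') in
/-- The adjoint of the differential. -/
def pushAdj (Φ : P → Q) (p : P) : TangentSpace 𝓘(ℝ, E') (Φ p) →ₗ[ℝ] TangentSpace 𝓘(ℝ, E) p :=
  LinearMap.adjoint (push E E' Φ p).toLinearMap

theorem inner_pushAdj_left (p : P) (w : TangentSpace 𝓘(ℝ, E') (Φ p))
    (z : TangentSpace 𝓘(ℝ, E) p) :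
    inner ℝ (pushAdj E E' Φ p w) z = inner ℝ w (push E E' Φ p z) :=
  LinearMap.adjoint_inner_left (push E E' Φ p).toLinearMap z w

theorem push_mem_rangeDist (p : P) (x : TangentSpace 𝓘(ℝ, E) p) :
    push E E' Φ p x ∈ rangeDist E E' Φ p :=
  ⟨x, rfl⟩

theorem mem_kerDist {p : P} {x : TangentSpace 𝓘(ℝ, E) p} :
    x ∈ kerDist E E' Φ p ↔ push E E' Φ p x = 0 :=
  LinearMap.mem_ker

theorem pushAdj_mem_horDist (p : P) (w : TangentSpace 𝓘(ℝ, E') (Φ p)) :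
    pushAdj E E' Φ p w ∈ horDist E E' Φ p := by
  intro z hz
  rw [real_inner_comm, inner_pushAdj_left, mem_kerDist.1 hz, inner_zero_right]

theorem mem_kerDist_of_inner {p : P} {x : TangentSpace 𝓘(ℝ, E) p}
    (h : ∀ z ∈ horDist E E' Φ p, inner ℝ x z = 0) : x ∈ kerDist E E' Φ p := by
  rw [← Submodule.orthogonal_orthogonal (kerDist E E' Φ p)]
  intro z hz
  rw [real_inner_comm]
  exact h z hz

theorem tangentPart_add_normalPart (p : P) (w : TangentSpace 𝓘(ℝ, E') (Φ p)) :
    tangentPart E Φ p w + normalPart E Φ p w = w :=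
  (rangeDist E E' Φ p).starProjection_add_starProjection_orthogonal w

theorem tangentPart_mem (p : P) (w : TangentSpace 𝓘(ℝ, E') (Φ p)) :
    tangentPart E Φ p w ∈ rangeDist E E' Φ p :=
  Submodule.starProjection_apply_mem _ w

theorem normalPart_mem (p : P) (w : TangentSpace 𝓘(ℝ, E') (Φ p)) :
    normalPart E Φ p w ∈ (rangeDist E E' Φ p)ᗮ :=
  Submodule.starProjection_apply_mem _ w

theorem inner_push_normal {p : P} {u : TangentSpace 𝓘(ℝ, E') (Φ p)}
    (hu : u ∈ (rangeDist E E' Φ p)ᗮ) (x : TangentSpace 𝓘(ℝ, E) p) :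
    inner ℝ (push E E' Φ p x) u = 0 :=
  hu _ (push_mem_rangeDist p x)

theorem tangentPart_eq_iff {p : P} {w t : TangentSpace 𝓘(ℝ, E') (Φ p)}
    (ht : t ∈ rangeDist E E' Φ p)
    (h : ∀ z : TangentSpace 𝓘(ℝ, E) p,
      inner ℝ w (push E E' Φ p z) = inner ℝ t (push E E' Φ p z)) :
    tangentPart E Φ p w = t := by
  refine Submodule.eq_starProjection_of_mem_of_inner_eq_zero ht ?_
  rintro _ ⟨z, rfl⟩
  rw [inner_sub_left, sub_eq_zero]
  exact h z

theorem inner_tangentPart {p : P} {w t : TangentSpace 𝓘(ℝ, E') (Φ p)}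
    (ht : t ∈ rangeDist E E' Φ p) : inner ℝ (tangentPart E Φ p w) t = inner ℝ w t := by
  conv_rhs => rw [← tangentPart_add_normalPart (E := E) p w, inner_add_left,
    Submodule.inner_left_of_mem_orthogonal ht (normalPart_mem p w), add_zero]

theorem inner_normalPart {p : P} {w u : TangentSpace 𝓘(ℝ, E') (Φ p)}
    (hu : u ∈ (rangeDist E E' Φ p)ᗮ) : inner ℝ (normalPart E Φ p w) u = inner ℝ w u := by
  conv_rhs => rw [← tangentPart_add_normalPart (E := E) p w, inner_add_left,
    Submodule.inner_right_of_mem_orthogonal (tangentPart_mem p w) hu, zero_add]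

/-- One horizontal argument suffices: the vertical part of z is killed by the differential and is
orthogonal to y. -/
theorem IsRiemannianMap.inner_push (hΦ : IsRiemannianMap E E' Φ) {p : P}
    {y : TangentSpace 𝓘(ℝ, E) p} (hy : y ∈ horDist E E' Φ p) (z : TangentSpace 𝓘(ℝ, E) p) :
    inner ℝ (push E E' Φ p y) (push E E' Φ p z) = inner ℝ y z := by
  have hz := (kerDist E E' Φ p).starProjection_add_starProjection_orthogonal z
  have h1 := (kerDist E E' Φ p).starProjection_apply_mem z
  have h2 : (kerDist E E' Φ p)ᗮ.starProjection z ∈ horDist E E' Φ p :=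
    Submodule.starProjection_apply_mem _ z
  rw [← hz, map_add, mem_kerDist.1 h1, zero_add, hΦ.2 p y hy _ h2, inner_add_right,
    Submodule.inner_left_of_mem_orthogonal h1 hy, zero_add]

theorem IsRiemannianMap.pushAdj_push (hΦ : IsRiemannianMap E E' Φ) {p : P}
    {y : TangentSpace 𝓘(ℝ, E) p} (hy : y ∈ horDist E E' Φ p) :
    pushAdj E E' Φ p (push E E' Φ p y) = y := by
  refine ext_inner_right ℝ fun z => ?_
  rw [inner_pushAdj_left, hΦ.inner_push hy]

/-- Expresses the tangential projection through the differential and its adjoint, so that its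
smoothness needs no local frames of the range. -/
theorem IsRiemannianMap.push_pushAdj (hΦ : IsRiemannianMap E E' Φ) (p : P)
    (w : TangentSpace 𝓘(ℝ, E') (Φ p)) :
    push E E' Φ p (pushAdj E E' Φ p w) = tangentPart E Φ p w := by
  refine (tangentPart_eq_iff (push_mem_rangeDist p _) fun z => ?_).symm
  rw [hΦ.inner_push (pushAdj_mem_horDist p w), inner_pushAdj_left]

theorem tangentPart_of_mem {p : P} {w : TangentSpace 𝓘(ℝ, E') (Φ p)}
    (hw : w ∈ rangeDist E E' Φ p) : tangentPart E Φ p w = w :=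
  tangentPart_eq_iff hw fun _ => rfl

theorem IsRiemannianMap.sub_pushAdj_mem_kerDist (hΦ : IsRiemannianMap E E' Φ) (p : P)
    (x : TangentSpace 𝓘(ℝ, E) p) :
    x - pushAdj E E' Φ p (push E E' Φ p x) ∈ kerDist E E' Φ p := by
  rw [mem_kerDist, map_sub, hΦ.push_pushAdj, tangentPart_of_mem (push_mem_rangeDist p x), sub_self]

section Smoothness

theorem IsRiemannianMap.smooth_push (hΦ : IsRiemannianMap E E' Φ)
    {Y : ∀ p : P, TangentSpace 𝓘(ℝ, E) p} {p : P} (hY : SmoothAlongAt E (fun y : P => y) Y p) :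
    SmoothAlongAt E Φ (fun p' => push E E' Φ p' (Y p')) p :=
  SmoothAlongAt.mfderiv hΦ.1 hY

variable [IsContMDiffRiemannianBundle 𝓘(ℝ, E) ∞ E (fun x : P => TangentSpace 𝓘(ℝ, E) x)]
  [IsContMDiffRiemannianBundle 𝓘(ℝ, E') ∞ E' (fun x : Q => TangentSpace 𝓘(ℝ, E') x)]
  {W : ∀ p : P, TangentSpace 𝓘(ℝ, E') (Φ p)} {p : P}

/-- Paired with a coordinate field, the adjoint moves to the other side and becomes the
differential, which is smooth. -/
theorem IsRiemannianMap.smooth_pushAdj (hΦ : IsRiemannianMap E E' Φ)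
    (hW : SmoothAlongAt E Φ W p) :
    SmoothAlongAt E (fun y : P => y) (fun p' => pushAdj E E' Φ p' (W p')) p := by
  refine smoothAlongAt_of_inner contMDiffAt_id fun e => ?_
  simp only [inner_pushAdj_left]
  exact hW.inner (hΦ.smooth_push (SmoothAlongAt.ofCoord_const contMDiffAt_id e))

theorem IsRiemannianMap.smooth_tangentPart (hΦ : IsRiemannianMap E E' Φ)
    (hW : SmoothAlongAt E Φ W p) :
    SmoothAlongAt E Φ (fun p' => tangentPart E Φ p' (W p')) p := by
  simp only [← hΦ.push_pushAdj]
  exact hΦ.smooth_push (hΦ.smooth_pushAdj hW)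

theorem IsRiemannianMap.smooth_normalPart (hΦ : IsRiemannianMap E E' Φ)
    (hW : SmoothAlongAt E Φ W p) :
    SmoothAlongAt E Φ (fun p' => normalPart E Φ p' (W p')) p := by
  refine (hW.sub (hΦ.smooth_tangentPart hW)).congr (Filter.Eventually.of_forall fun p' => ?_)
  exact eq_sub_of_add_eq' (tangentPart_add_normalPart p' (W p'))

variable [T2Space P]

theorem IsRiemannianMap.exists_section_horDist (hΦ : IsRiemannianMap E E' Φ) {p : P}
    {x : TangentSpace 𝓘(ℝ, E) p} (hx : x ∈ horDist E E' Φ p) :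
    ∃ X : ∀ p : P, TangentSpace 𝓘(ℝ, E) p, IsSectionOf (horDist E E' Φ) X ∧ X p = x := by
  obtain ⟨Z, hZ, rfl⟩ := exists_smooth_extension_vector p x
  refine ⟨fun p' => pushAdj E E' Φ p' (push E E' Φ p' (Z p')), ⟨?_, fun p' =>
    pushAdj_mem_horDist p' _⟩, hΦ.pushAdj_push hx⟩
  rw [isSmoothFieldOn_univ_iff] at hZ ⊢
  exact fun p' => hΦ.smooth_pushAdj (hΦ.smooth_push (hZ p'))

theorem IsRiemannianMap.exists_section_kerDist (hΦ : IsRiemannianMap E E' Φ) {p : P}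
    {x : TangentSpace 𝓘(ℝ, E) p} (hx : x ∈ kerDist E E' Φ p) :
    ∃ X : ∀ p : P, TangentSpace 𝓘(ℝ, E) p, IsSectionOf (kerDist E E' Φ) X ∧ X p = x := by
  obtain ⟨Z, hZ, rfl⟩ := exists_smooth_extension_vector p x
  refine ⟨fun p' => Z p' - pushAdj E E' Φ p' (push E E' Φ p' (Z p')), ⟨?_, fun p' =>
    hΦ.sub_pushAdj_mem_kerDist p' _⟩, ?_⟩
  · rw [isSmoothFieldOn_univ_iff] at hZ ⊢
    exact fun p' => (hZ p').sub (hΦ.smooth_pushAdj (hΦ.smooth_push (hZ p')))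
  · change Z p - pushAdj E E' Φ p (push E E' Φ p (Z p)) = Z p
    rw [mem_kerDist.1 hx, map_zero, sub_zero]

end Smoothness

section Slant

variable {J : ∀ q : Q, TangentSpace 𝓘(ℝ, E') q →L[ℝ] TangentSpace 𝓘(ℝ, E') q} {θ : ℝ}

theorem opAlpha_add_opDelta (p : P) (w : TangentSpace 𝓘(ℝ, E') (Φ p)) :
    opAlpha E Φ J p w + opDelta E Φ J p w = J (Φ p) w :=
  tangentPart_add_normalPart p _

theorem opB_add_opC (p : P) (u : TangentSpace 𝓘(ℝ, E') (Φ p)) :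
    opB E Φ J p u + opC E Φ J p u = J (Φ p) u :=
  tangentPart_add_normalPart p _

/-- Since αw is the projection of Jw, ⟨Jw,αw⟩ = |αw|², and |Jw| = |w|; the cosine of the slant angle
is therefore |αw|/|w|. -/
theorem inner_opAlpha_self (hΦ : IsRiemannianMap E E' Φ) (hJ : IsKahler J)
    (hθ : IsSlant E Φ J θ) {p : P} {w : TangentSpace 𝓘(ℝ, E') (Φ p)}
    (hw : w ∈ rangeDist E E' Φ p) :
    inner ℝ (opAlpha E Φ J p w) (opAlpha E Φ J p w) = Real.cos θ ^ 2 * inner ℝ w w := by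
  by_cases hw0 : w = 0
  · simp [hw0, opAlpha, tangentPart]
  have hx : push E E' Φ p (pushAdj E E' Φ p w) = w := by
    rw [hΦ.push_pushAdj, tangentPart_of_mem hw]
  have hx0 : pushAdj E E' Φ p w ≠ 0 := by
    intro h
    rw [h, map_zero] at hx
    exact hw0 hx.symm
  have h := hθ p _ (pushAdj_mem_horDist p w) hx0
  rw [hx] at h
  have hJw : inner ℝ (J (Φ p) w) (J (Φ p) w) = inner ℝ w w := hJ.orthogonal _ w w
  have hin : inner ℝ (J (Φ p) w) (tangentPart E Φ p (J (Φ p) w))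
      = inner ℝ (tangentPart E Φ p (J (Φ p) w)) (tangentPart E Φ p (J (Φ p) w)) :=
    (inner_tangentPart (tangentPart_mem p _)).symm
  have hcos := InnerProductGeometry.cos_angle (J (Φ p) w) (tangentPart E Φ p (J (Φ p) w))
  rw [h, hin, real_inner_self_eq_norm_sq] at hcos
  have hnJ : ‖J (Φ p) w‖ = ‖w‖ := by
    rw [real_inner_self_eq_norm_sq, real_inner_self_eq_norm_sq] at hJw
    exact (sq_eq_sq₀ (norm_nonneg _) (norm_nonneg _)).1 hJw
  have hn0 : ‖w‖ ≠ 0 := norm_ne_zero_iff.2 hw0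
  unfold opAlpha
  rw [hcos, hnJ, real_inner_self_eq_norm_sq, real_inner_self_eq_norm_sq]
  by_cases h0 : ‖tangentPart E Φ p (J (Φ p) w)‖ = 0
  · rw [h0]
    simp
  · field_simp

theorem opAlpha_add (p : P) (w w' : TangentSpace 𝓘(ℝ, E') (Φ p)) :
    opAlpha E Φ J p (w + w') = opAlpha E Φ J p w + opAlpha E Φ J p w' := by
  simp [opAlpha, tangentPart]

/-- Polarize the length formula for α and use that α is skew on the range, because J is. -/
theorem opAlpha_opAlpha (hΦ : IsRiemannianMap E E' Φ) (hJ : IsKahler J)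
    (hθ : IsSlant E Φ J θ) {p : P} {w : TangentSpace 𝓘(ℝ, E') (Φ p)}
    (hw : w ∈ rangeDist E E' Φ p) :
    opAlpha E Φ J p (opAlpha E Φ J p w) = -(Real.cos θ ^ 2 • w) := by
  have hpol : ∀ w' ∈ rangeDist E E' Φ p,
      inner ℝ (opAlpha E Φ J p w) (opAlpha E Φ J p w') = Real.cos θ ^ 2 * inner ℝ w w' := by
    intro w' hw'
    have h1 := inner_opAlpha_self hΦ hJ hθ (Submodule.add_mem _ hw hw')
    have h2 := inner_opAlpha_self hΦ hJ hθ hw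
    have h3 := inner_opAlpha_self hΦ hJ hθ hw'
    rw [opAlpha_add, inner_add_left, inner_add_right, inner_add_right, inner_add_left,
      inner_add_right, inner_add_right, h2, h3, real_inner_comm w w',
      real_inner_comm (opAlpha E Φ J p w) (opAlpha E Φ J p w')] at h1
    linarith
  refine tangentPart_eq_iff (Submodule.neg_mem _ (Submodule.smul_mem _ _ hw)) fun z => ?_
  have hz := push_mem_rangeDist (E' := E') (Φ := Φ) p z
  rw [hJ.inner_left, inner_neg_left, real_inner_smul_left, ← hpol _ hz, neg_inj, real_inner_comm]
  conv_rhs => rw [real_inner_comm]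
  exact (inner_tangentPart (tangentPart_mem p _)).symm

end Slant

end RiemannianMaps

/-! ### Second fundamental form under the Riemannian, Clairaut and slant conditions. -/

section SlantRiemannianMaps

variable {E : Type*} [NormedAddCommGroup E] [NormedSpace ℝ E] [FiniteDimensional ℝ E]
  {P : Type*} [TopologicalSpace P] [T2Space P] [ChartedSpace E P] [IsManifold 𝓘(ℝ, E) ∞ P]
  [RiemannianBundle (fun x : P => TangentSpace 𝓘(ℝ, E) x)]
  [IsContMDiffRiemannianBundle 𝓘(ℝ, E) ∞ E (fun x : P => TangentSpace 𝓘(ℝ, E) x)]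
  {E' : Type*} [NormedAddCommGroup E'] [NormedSpace ℝ E'] [FiniteDimensional ℝ E']
  {Q : Type*} [TopologicalSpace Q] [T2Space Q] [ChartedSpace E' Q] [IsManifold 𝓘(ℝ, E') ∞ Q]
  [RiemannianBundle (fun x : Q => TangentSpace 𝓘(ℝ, E') x)]
  [IsContMDiffRiemannianBundle 𝓘(ℝ, E') ∞ E' (fun x : Q => TangentSpace 𝓘(ℝ, E') x)]
  {J : ∀ q : Q, TangentSpace 𝓘(ℝ, E') q →L[ℝ] TangentSpace 𝓘(ℝ, E') q}
  {Φ : P → Q} {θ : ℝ} {f : Q → ℝ} {p : P}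

theorem IsSectionOf.smoothAlongAt {D : ∀ x : P, Submodule ℝ (TangentSpace 𝓘(ℝ, E) x)}
    {Y : ∀ p : P, TangentSpace 𝓘(ℝ, E) p} (hY : IsSectionOf D Y) (p : P) :
    SmoothAlongAt E (fun y : P => y) Y p :=
  hY.1.smoothAlongAt Filter.univ_mem

theorem IsRiemannianMap.covAlong_push (hΦ : IsRiemannianMap E E' Φ)
    {Y : ∀ p : P, TangentSpace 𝓘(ℝ, E) p} (hY : SmoothAlongAt E (fun y : P => y) Y p)
    (x : TangentSpace 𝓘(ℝ, E) p) :
    covAlong Φ (fun p' => push E E' Φ p' (Y p')) p x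
      = sff Φ p x (Y p) + push E E' Φ p (leviCivita Y p x) := by
  obtain ⟨X, -, rfl⟩ := exists_smooth_extension_vector p x
  rw [← secondFundamentalForm_eq_sff hΦ.1 p X hY]
  exact (sub_add_cancel _ _).symm

/-- The second fundamental form of a Riemannian map takes values in `(range Φ_*)^⊥` on horizontal
vectors. -/
theorem IsRiemannianMap.inner_sff_push (hΦ : IsRiemannianMap E E' Φ)
    {x y : TangentSpace 𝓘(ℝ, E) p} (hx : x ∈ horDist E E' Φ p) (hy : y ∈ horDist E E' Φ p)
    (z : TangentSpace 𝓘(ℝ, E) p) :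
    inner ℝ (sff Φ p x y) (push E E' Φ p z) = 0 := by
  -- Differentiating ⟨Φ_*Y,Φ_*Z⟩ = ⟨Y,Z⟩ for horizontal Y, Z makes the trilinear form ⟨S(x,y),Φ_*z⟩
  -- skew in its last two arguments.
  have hanti : ∀ x y z : TangentSpace 𝓘(ℝ, E) p, y ∈ horDist E E' Φ p → z ∈ horDist E E' Φ p →
      inner ℝ (sff Φ p x y) (push E E' Φ p z) = -inner ℝ (sff Φ p x z) (push E E' Φ p y) := by
    intro x y z hy hz
    obtain ⟨Y, hY, rfl⟩ := hΦ.exists_section_horDist hy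
    obtain ⟨Z, hZ, rfl⟩ := hΦ.exists_section_horDist hz
    have h1 := mvfderiv_inner (hY.smoothAlongAt p) (hZ.smoothAlongAt p) x
    have h2 := mvfderiv_inner (hΦ.smooth_push (hY.smoothAlongAt p))
      (hΦ.smooth_push (hZ.smoothAlongAt p)) x
    have heq : (fun p' => inner ℝ (push E E' Φ p' (Y p')) (push E E' Φ p' (Z p')))
        = fun p' => inner ℝ (Y p') (Z p') := funext fun p' => hΦ.inner_push (hY.2 p') _
    rw [heq, h1, hΦ.covAlong_push (hY.smoothAlongAt p), hΦ.covAlong_push (hZ.smoothAlongAt p),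
      inner_add_left, inner_add_right, hΦ.inner_push (hY.2 p),
      real_inner_comm (push E E' Φ p (Z p)) (push E E' Φ p (leviCivita Y p x)),
      hΦ.inner_push (hZ.2 p), real_inner_comm (leviCivita Y p x) (Z p),
      real_inner_comm (sff Φ p x (Z p))] at h2
    unfold leviCivita at h2
    linarith
  -- z may be replaced by its horizontal part, which has the same image.
  have hker := hΦ.sub_pushAdj_mem_kerDist p z
  rw [mem_kerDist, map_sub, sub_eq_zero] at hker
  rw [hker]
  have hz := pushAdj_mem_horDist (E := E) p (push E E' Φ p z)
  generalize pushAdj E E' Φ p (push E E' Φ p z) = z at hz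
  -- A trilinear form symmetric in the first two arguments and skew in the last two is zero.
  have h1 := hanti x y z hy hz
  rw [sff_symm hΦ.1 p x z, hanti z x y hx hy, sff_symm hΦ.1 p z y, hanti y z x hz hx,
    sff_symm hΦ.1 p y x] at h1
  linarith

/-- The shape operator of a normal field is adjoint to the derivative of tangential fields. -/
theorem inner_covAlong_normal {U W : ∀ p : P, TangentSpace 𝓘(ℝ, E') (Φ p)}
    (hU : SmoothAlongAt E Φ U p) (hW : SmoothAlongAt E Φ W p)
    (hUn : ∀ p, U p ∈ (rangeDist E E' Φ p)ᗮ) (hWt : ∀ p, W p ∈ rangeDist E E' Φ p)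
    (x : TangentSpace 𝓘(ℝ, E) p) :
    inner ℝ (covAlong Φ U p x) (W p) = -inner ℝ (covAlong Φ W p x) (U p) := by
  have h := mvfderiv_inner hU hW x
  have h0 : (fun p' => inner ℝ (U p') (W p')) = fun _ => (0 : ℝ) :=
    funext fun p' => Submodule.inner_left_of_mem_orthogonal (hWt p') (hUn p')
  rw [h0, mvfderiv_const] at h
  rw [real_inner_comm (U p)]
  simp at h
  linarith

/-- The Clairaut condition makes the derivative of tangential fields umbilical. -/
theorem IsClairaut.inner_covAlong (hΦ : IsRiemannianMap E E' Φ)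
    (hf : ContMDiff 𝓘(ℝ, E') 𝓘(ℝ, ℝ) ∞ f)
    (hC : IsClairaut E E' Φ (fun q => Real.exp (f q)))
    {W : ∀ p : P, TangentSpace 𝓘(ℝ, E') (Φ p)} (hW : SmoothAlongAt E Φ W p)
    (hWt : ∀ p, W p ∈ rangeDist E E' Φ p) {u : TangentSpace 𝓘(ℝ, E') (Φ p)}
    (hu : u ∈ (rangeDist E E' Φ p)ᗮ) (x : TangentSpace 𝓘(ℝ, E) p) :
    inner ℝ (covAlong Φ W p x) u
      = -(mvfderiv 𝓘(ℝ, E') f (Φ p) u * inner ℝ (push E E' Φ p x) (W p)) := by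
  obtain ⟨-, hC⟩ := hC
  obtain ⟨N, hN, V, hVo, hmaps, D, hD, hDr, hgeo⟩ := hC p
  have hpN : p ∈ N := mem_of_mem_nhds hN
  have hV : V ∈ 𝓝 (Φ p) := hVo.mem_nhds (hmaps hpN)
  have hT : SmoothOpAt (projOp D) (Φ p) := hD.smoothOpAt hV
  have hproj : ∀ p' ∈ N, ∀ w ∈ rangeDist E E' Φ p', projOp D (Φ p') w = w := by
    intro p' hp' w hw
    rw [← hDr p' hp'] at hw
    exact Submodule.starProjection_eq_self_iff.2 hw
  have huD : u ∈ (D (Φ p))ᗮ := by rwa [hDr p hpN]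
  have hTu : ∀ v, inner ℝ (projOp D (Φ p) v) u = 0 := fun v =>
    huD _ (Submodule.starProjection_apply_mem _ v)
  have hcov : ∀ W : ∀ p : P, TangentSpace 𝓘(ℝ, E') (Φ p), SmoothAlongAt E Φ W p →
      (∀ p, W p ∈ rangeDist E E' Φ p) → ∀ x,
      inner ℝ (covAlong Φ W p x) u
        = inner ℝ (covOp (projOp D) (Φ p) (push E E' Φ p x) (W p)) u := by
    intro W hW hWt x
    -- Near p the field W is fixed by the projection, so its normal derivative comes entirely from
    -- ∇T.
    have h1 : covAlong Φ W p x = covAlong Φ (fun p' => projOp D (Φ p') (W p')) p x := by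
      refine covAlong_congr ?_ x
      filter_upwards [hN] with p' hp'
      exact (hproj p' hp' _ (hWt p')).symm
    rw [h1, hT.covAlong_apply hW, inner_add_left, hTu, add_zero]
    rfl
  have hsff : ∀ x y, inner ℝ (covOp (projOp D) (Φ p) (push E E' Φ p x) (push E E' Φ p y)) u
      = inner ℝ (sff Φ p x y) u := by
    intro x y
    obtain ⟨Y, hY, rfl⟩ := exists_smooth_extension_vector p y
    have hYp := hY.smoothAlongAt (x := p) Filter.univ_mem
    rw [← hcov _ (hΦ.smooth_push hYp) (fun p' => push_mem_rangeDist p' _), hΦ.covAlong_push hYp,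
      inner_add_left, inner_push_normal hu, add_zero]
  have hdiag : ∀ x, inner ℝ (sff Φ p x x) u
      = -(mvfderiv 𝓘(ℝ, E') f (Φ p) u * inner ℝ (push E E' Φ p x) (push E E' Φ p x)) := by
    intro x
    rw [← hsff]
    refine clairaut_projection hT (clairaut_quadratic hf hD hgeo hV) ?_ huD
    rw [hDr p hpN]
    exact push_mem_rangeDist p x
  obtain ⟨y, hy⟩ : W p ∈ rangeDist E E' Φ p := hWt p
  have hy' : push E E' Φ p y = W p := hy
  rw [hcov W hW hWt, ← hy', hsff]
  -- Polarization; it uses the symmetry of S, which `covOp` alone does not provide.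
  have h1 := hdiag (x + y)
  rw [sff_add_left, sff_add_right, sff_add_right, sff_symm hΦ.1 p y x, map_add, inner_add_left,
    inner_add_left, inner_add_left, hdiag, hdiag, inner_add_left, inner_add_right, inner_add_right,
    real_inner_comm (push E E' Φ p x) (push E E' Φ p y)] at h1
  linarith

section Decomposition

variable {W : ∀ p : P, TangentSpace 𝓘(ℝ, E') (Φ p)}

theorem smooth_opAlpha (hΦ : IsRiemannianMap E E' Φ) (hJ : IsKahler J)
    (hW : SmoothAlongAt E Φ W p) : SmoothAlongAt E Φ (fun p' => opAlpha E Φ J p' (W p')) p :=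
  hΦ.smooth_tangentPart (hJ.smoothAlongAt hW)

theorem smooth_opDelta (hΦ : IsRiemannianMap E E' Φ) (hJ : IsKahler J)
    (hW : SmoothAlongAt E Φ W p) : SmoothAlongAt E Φ (fun p' => opDelta E Φ J p' (W p')) p :=
  hΦ.smooth_normalPart (hJ.smoothAlongAt hW)

/-- The consequence of `∇J = 0` for a tangential field of a slant map. -/
theorem covAlong_slant (hΦ : IsRiemannianMap E E' Φ) (hJ : IsKahler J) (hθ : IsSlant E Φ J θ)
    (hW : SmoothAlongAt E Φ W p) (hWt : ∀ p, W p ∈ rangeDist E E' Φ p)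
    (x : TangentSpace 𝓘(ℝ, E) p) :
    (Real.cos θ ^ 2 - 1) • covAlong Φ W p x
      = covAlong Φ (fun p' => opDelta E Φ J p' (opAlpha E Φ J p' (W p'))) p x
        + J (Φ p) (covAlong Φ (fun p' => opDelta E Φ J p' (W p')) p x) := by
  have hα := smooth_opAlpha hΦ hJ hW
  have hδ := smooth_opDelta hΦ hJ hW
  have h1 := hJ.covAlong hW x
  rw [covAlong_congr (Filter.Eventually.of_forall fun p' =>
    (opAlpha_add_opDelta (E := E) p' (W p')).symm) x, covAlong_add hα hδ] at h1
  have h2 := hJ.covAlong hα x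
  have h3 : covAlong Φ (fun p' => J (Φ p') (opAlpha E Φ J p' (W p'))) p x
      = covAlong Φ (fun p' => (-(Real.cos θ ^ 2)) • W p'
        + opDelta E Φ J p' (opAlpha E Φ J p' (W p'))) p x := by
    refine covAlong_congr (Filter.Eventually.of_forall fun p' => ?_) x
    rw [← opAlpha_add_opDelta (E := E), opAlpha_opAlpha hΦ hJ hθ (hWt p'), neg_smul]
  rw [h3, covAlong_add (hW.const_smul _) (smooth_opDelta hΦ hJ hα),
    covAlong_const_smul hW] at h2
  -- A second application of J turns J∇(αW) into ∇(JαW), where α² = -cos²θ has been used.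
  have h4 := congrArg (J (Φ p)) h1
  rw [hJ.sq, map_add, ← h2] at h4
  rw [sub_smul, one_smul]
  rw [neg_smul] at h4
  have h5 := eq_neg_of_add_eq_zero_left (show
    (Real.cos θ ^ 2 • covAlong Φ W p x - covAlong Φ W p x)
      + -(covAlong Φ (fun p' => opDelta E Φ J p' (opAlpha E Φ J p' (W p'))) p x
        + J (Φ p) (covAlong Φ (fun p' => opDelta E Φ J p' (W p')) p x)) = 0 by
    rw [sub_eq_add_neg, ← h4]
    abel)
  rwa [neg_neg] at h5

/-- The left-hand side of the slant identity in terms of the second fundamental form and of the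
shape operators. -/
theorem slantIdentity_lhs (hΦ : IsRiemannianMap E E' Φ) (hJ : IsKahler J)
    (hθ : IsSlant E Φ J θ) {Y : ∀ p : P, TangentSpace 𝓘(ℝ, E) p}
    (hY : SmoothAlongAt E (fun y : P => y) Y p) (x : TangentSpace 𝓘(ℝ, E) p) :
    Real.cos θ ^ 2 • push E E' Φ p (leviCivita Y p x)
        - normalCov E Φ (fun x => opDelta E Φ J x (opAlpha E Φ J x (push E E' Φ x (Y x)))) p x
        - opB E Φ J p (normalCov E Φ (fun x => opDelta E Φ J x (push E E' Φ x (Y x))) p x)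
        - opC E Φ J p (normalCov E Φ (fun x => opDelta E Φ J x (push E E' Φ x (Y x))) p x)
        - push E E' Φ p (leviCivita Y p x)
      = tangentPart E Φ p (covAlong Φ
          (fun x => opDelta E Φ J x (opAlpha E Φ J x (push E E' Φ x (Y x)))) p x)
        + J (Φ p) (tangentPart E Φ p
          (covAlong Φ (fun x => opDelta E Φ J x (push E E' Φ x (Y x))) p x))
        - (Real.cos θ ^ 2 - 1) • sff Φ p x (Y p) := by
  have hW := hΦ.smooth_push hY
  have h1 := covAlong_slant hΦ hJ hθ hW (fun p' => push_mem_rangeDist p' _) x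
  -- The derivative of W is S plus the image of ∇Y. Splitting the other two derivatives too, their
  -- normal parts give the terms of the slant identity, and B + C = J on normal vectors.
  rw [hΦ.covAlong_push hY] at h1
  unfold normalCov
  set a := covAlong Φ (fun x => opDelta E Φ J x (opAlpha E Φ J x (push E E' Φ x (Y x)))) p x
  set b := covAlong Φ (fun x => opDelta E Φ J x (push E E' Φ x (Y x))) p x
  have ha := tangentPart_add_normalPart (E := E) p a
  have hb := tangentPart_add_normalPart (E := E) p b
  have hbc := opB_add_opC (E := E) (J := J) p (normalPart E Φ p b)
  rw [smul_add] at h1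
  nth_rewrite 1 [← ha] at h1
  nth_rewrite 1 [← hb] at h1
  rw [map_add, ← hbc, sub_smul _ _ (push E E' Φ p (leviCivita Y p x)), one_smul] at h1
  rw [← sub_eq_zero] at h1 ⊢
  rw [← h1]
  abel

end Decomposition

end SlantRiemannianMaps

/-! ### Both implications of the theorem. -/

section TotallyGeodesic

variable {E : Type*} [NormedAddCommGroup E] [NormedSpace ℝ E] [FiniteDimensional ℝ E]
  {P : Type*} [TopologicalSpace P] [T2Space P] [ChartedSpace E P] [IsManifold 𝓘(ℝ, E) ∞ P]
  [RiemannianBundle (fun x : P => TangentSpace 𝓘(ℝ, E) x)]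
  [IsContMDiffRiemannianBundle 𝓘(ℝ, E) ∞ E (fun x : P => TangentSpace 𝓘(ℝ, E) x)]
  {E' : Type*} [NormedAddCommGroup E'] [NormedSpace ℝ E'] [FiniteDimensional ℝ E']
  {Q : Type*} [TopologicalSpace Q] [T2Space Q] [ChartedSpace E' Q] [IsManifold 𝓘(ℝ, E') ∞ Q]
  [RiemannianBundle (fun x : Q => TangentSpace 𝓘(ℝ, E') x)]
  [IsContMDiffRiemannianBundle 𝓘(ℝ, E') ∞ E' (fun x : Q => TangentSpace 𝓘(ℝ, E') x)]
  {J : ∀ q : Q, TangentSpace 𝓘(ℝ, E') q →L[ℝ] TangentSpace 𝓘(ℝ, E') q}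
  {Φ : P → Q} {θ : ℝ} {f : Q → ℝ} {p : P}

theorem isTotallyGeodesicMap_iff (hΦ : ContMDiff 𝓘(ℝ, E) 𝓘(ℝ, E') ∞ Φ) :
    IsTotallyGeodesicMap E E' Φ ↔ ∀ p x y, sff (E := E) (E' := E') Φ p x y = 0 := by
  constructor
  · intro h p x y
    obtain ⟨X, hX, rfl⟩ := exists_smooth_extension_vector p x
    obtain ⟨Y, hY, rfl⟩ := exists_smooth_extension_vector p y
    rw [← secondFundamentalForm_eq_sff hΦ p X (hY.smoothAlongAt Filter.univ_mem)]
    exact h X Y hX hY p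
  · intro h X Y _ hY p
    rw [secondFundamentalForm_eq_sff hΦ p X (hY.smoothAlongAt Filter.univ_mem)]
    exact h p _ _

theorem IsRiemannianMap.sff_section_kerDist (hΦ : IsRiemannianMap E E' Φ)
    {Y : ∀ p : P, TangentSpace 𝓘(ℝ, E) p} (hY : IsSectionOf (kerDist E E' Φ) Y)
    (x : TangentSpace 𝓘(ℝ, E) p) :
    sff Φ p x (Y p) = -push E E' Φ p (leviCivita Y p x) := by
  have hYp := hY.smoothAlongAt p
  -- The zero field is written as a multiple by 0, so that homogeneity of the connection shows its
  -- derivative vanishes.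
  have h0 : covAlong Φ (fun p' => push E E' Φ p' (Y p')) p x
      = covAlong Φ (fun p' => (0 : ℝ) • push E E' Φ p' (Y p')) p x :=
    covAlong_congr (Filter.Eventually.of_forall fun p' => by
      rw [zero_smul, mem_kerDist.1 (hY.2 p')]) x
  rw [covAlong_const_smul (hΦ.smooth_push hYp), zero_smul, hΦ.covAlong_push hYp] at h0
  exact eq_neg_of_add_eq_zero_left h0

theorem IsRiemannianMap.isTotallyGeodesicDistribution_kerDist (hΦ : IsRiemannianMap E E' Φ)
    (h : ∀ p x y, sff (E := E) (E' := E') Φ p x y = 0) :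
    IsTotallyGeodesicDistribution (kerDist E E' Φ) := by
  intro X Y _ hY p
  rw [mem_kerDist, ← neg_eq_zero, ← hΦ.sff_section_kerDist hY, h]

theorem IsRiemannianMap.isTotallyGeodesicDistribution_horDist (hΦ : IsRiemannianMap E E' Φ)
    (h : ∀ p x y, sff (E := E) (E' := E') Φ p x y = 0) :
    IsTotallyGeodesicDistribution (horDist E E' Φ) := by
  intro X Y _ hY p z hz
  obtain ⟨Z, hZ, rfl⟩ := exists_smooth_extension_vector p z
  have hYp := hY.smoothAlongAt p
  have hZp := hZ.smoothAlongAt (x := p) Filter.univ_mem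
  have h1 := mvfderiv_inner hYp hZp (X p)
  have h2 := mvfderiv_inner (hΦ.smooth_push hYp) (hΦ.smooth_push hZp) (X p)
  have heq : (fun p' => inner ℝ (push E E' Φ p' (Y p')) (push E E' Φ p' (Z p')))
      = fun p' => inner ℝ (Y p') (Z p') := funext fun p' => hΦ.inner_push (hY.2 p') _
  rw [heq, h1, hΦ.covAlong_push hYp, hΦ.covAlong_push hZp, h, h, zero_add, zero_add,
    hΦ.inner_push (hY.2 p), mem_kerDist.1 hz, inner_zero_right] at h2
  rw [real_inner_comm]
  unfold leviCivita at h2 ⊢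
  linarith

theorem slantIdentity_of_sff_eq_zero (hΦ : IsRiemannianMap E E' Φ) (hJ : IsKahler J)
    (hθ : IsSlant E Φ J θ) (h : ∀ p x y, sff (E := E) (E' := E') Φ p x y = 0) :
    SlantIdentity E Φ J θ := by
  intro X Y _ hY p
  have hYp := hY.smoothAlongAt p
  have hT : ∀ U : ∀ p : P, TangentSpace 𝓘(ℝ, E') (Φ p), SmoothAlongAt E Φ U p →
      (∀ p, U p ∈ (rangeDist E E' Φ p)ᗮ) →
      tangentPart E Φ p (covAlong Φ U p (X p)) = 0 := by
    intro U hU hUn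
    refine tangentPart_eq_iff (Submodule.zero_mem _) fun z => ?_
    obtain ⟨Z, hZ, rfl⟩ := exists_smooth_extension_vector p z
    have hZp := hZ.smoothAlongAt (x := p) Filter.univ_mem
    rw [inner_covAlong_normal hU (hΦ.smooth_push hZp) hUn (fun p' => push_mem_rangeDist p' _),
      hΦ.covAlong_push hZp, h, zero_add, inner_push_normal (hUn p), neg_zero, inner_zero_left]
  have hW := hΦ.smooth_push hYp
  rw [slantIdentity_lhs hΦ hJ hθ hYp, h, hT _ (smooth_opDelta hΦ hJ (smooth_opAlpha hΦ hJ hW))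
      fun p' => normalPart_mem p' _,
    hT _ (smooth_opDelta hΦ hJ hW) fun p' => normalPart_mem p' _]
  simp

/-- Otherwise every Gram–Schmidt remainder against w is zero, and w spans S. -/
theorem exists_inner_eq_zero_of_finrank_ne_one {V : Type*} [NormedAddCommGroup V]
    [InnerProductSpace ℝ V] {S : Submodule ℝ V} (hS : Module.finrank ℝ S ≠ 1) {w : V}
    (hw : w ∈ S) (hw0 : w ≠ 0) : ∃ v ∈ S, v ≠ 0 ∧ inner ℝ v w = 0 := by
  by_contra! hcon
  refine hS ((finrank_eq_one_iff_of_nonzero' (⟨w, hw⟩ : S)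
    fun h => hw0 (congrArg Subtype.val h)).2 fun v => ⟨inner ℝ (v : V) w / inner ℝ w w, ?_⟩)
  by_contra hne
  refine hcon ((v : V) - (inner ℝ (v : V) w / inner ℝ w w) • w)
    (S.sub_mem v.2 (S.smul_mem _ hw)) (fun h => hne (Subtype.ext (sub_eq_zero.1 h).symm)) ?_
  rw [inner_sub_left, real_inner_smul_left, div_mul_cancel₀ _ (inner_self_ne_zero.2 hw0), sub_self]

theorem inner_opDelta_self (hΦ : IsRiemannianMap E E' Φ) (hJ : IsKahler J)
    (hθ : IsSlant E Φ J θ) {w : TangentSpace 𝓘(ℝ, E') (Φ p)} (hw : w ∈ rangeDist E E' Φ p) :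
    inner ℝ (opDelta E Φ J p w) (opDelta E Φ J p w) = (1 - Real.cos θ ^ 2) * inner ℝ w w := by
  have h1 := hJ.orthogonal (Φ p) w w
  have h0 : inner ℝ (opAlpha E Φ J p w) (opDelta E Φ J p w) = 0 :=
    Submodule.inner_right_of_mem_orthogonal (tangentPart_mem p _) (normalPart_mem p _)
  rw [← opAlpha_add_opDelta (E := E), inner_add_left, inner_add_right, inner_add_right,
    real_inner_comm (opAlpha E Φ J p w) (opDelta E Φ J p w), h0,
    inner_opAlpha_self hΦ hJ hθ hw] at h1
  linarith

theorem IsClairaut.inner_sff (hΦ : IsRiemannianMap E E' Φ)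
    (hf : ContMDiff 𝓘(ℝ, E') 𝓘(ℝ, ℝ) ∞ f)
    (hC : IsClairaut E E' Φ (fun q => Real.exp (f q)))
    {u : TangentSpace 𝓘(ℝ, E') (Φ p)} (hu : u ∈ (rangeDist E E' Φ p)ᗮ)
    (x y : TangentSpace 𝓘(ℝ, E) p) :
    inner ℝ (sff Φ p x y) u
      = -(mvfderiv 𝓘(ℝ, E') f (Φ p) u * inner ℝ (push E E' Φ p x) (push E E' Φ p y)) := by
  obtain ⟨Y, hY, rfl⟩ := exists_smooth_extension_vector p y
  have hYp := hY.smoothAlongAt (x := p) Filter.univ_mem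
  rw [← hC.inner_covAlong hΦ hf (hΦ.smooth_push hYp) (fun p' => push_mem_rangeDist p' _) hu,
    hΦ.covAlong_push hYp, inner_add_left, inner_push_normal hu, add_zero]

/-- The shape operator of U is adjoint to the second fundamental form, hence is multiplication by
df(U) on the range. -/
theorem IsClairaut.tangentPart_covAlong (hΦ : IsRiemannianMap E E' Φ)
    (hf : ContMDiff 𝓘(ℝ, E') 𝓘(ℝ, ℝ) ∞ f)
    (hC : IsClairaut E E' Φ (fun q => Real.exp (f q)))
    {U : ∀ p : P, TangentSpace 𝓘(ℝ, E') (Φ p)} (hU : SmoothAlongAt E Φ U p)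
    (hUn : ∀ p, U p ∈ (rangeDist E E' Φ p)ᗮ) (x : TangentSpace 𝓘(ℝ, E) p) :
    tangentPart E Φ p (covAlong Φ U p x)
      = mvfderiv 𝓘(ℝ, E') f (Φ p) (U p) • push E E' Φ p x := by
  refine tangentPart_eq_iff (Submodule.smul_mem _ _ (push_mem_rangeDist p x)) fun z => ?_
  obtain ⟨Z, hZ, rfl⟩ := exists_smooth_extension_vector p z
  have hW := hΦ.smooth_push (hZ.smoothAlongAt (x := p) Filter.univ_mem)
  have hWt : ∀ p', push E E' Φ p' (Z p') ∈ rangeDist E E' Φ p' :=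
    fun p' => push_mem_rangeDist p' _
  rw [inner_covAlong_normal hU hW hUn hWt, hC.inner_covAlong hΦ hf hW hWt (hUn p), neg_neg,
    real_inner_smul_left]

/-- The normal component of the slant identity for a Clairaut map. -/
theorem SlantIdentity.inner_normal (hΦ : IsRiemannianMap E E' Φ) (hJ : IsKahler J)
    (hθ : IsSlant E Φ J θ) (hf : ContMDiff 𝓘(ℝ, E') 𝓘(ℝ, ℝ) ∞ f)
    (hC : IsClairaut E E' Φ (fun q => Real.exp (f q))) (hS : SlantIdentity E Φ J θ)
    {w w' u : TangentSpace 𝓘(ℝ, E') (Φ p)} (hw : w ∈ rangeDist E E' Φ p)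
    (hw' : w' ∈ rangeDist E E' Φ p) (hu : u ∈ (rangeDist E E' Φ p)ᗮ) :
    (Real.cos θ ^ 2 - 1) * (mvfderiv 𝓘(ℝ, E') f (Φ p) u * inner ℝ w w')
      + mvfderiv 𝓘(ℝ, E') f (Φ p) (opDelta E Φ J p w') * inner ℝ (opDelta E Φ J p w) u = 0 := by
  obtain ⟨X, hX, hXp⟩ := hΦ.exists_section_horDist (pushAdj_mem_horDist p w)
  obtain ⟨Y, hY, hYp⟩ := hΦ.exists_section_horDist (pushAdj_mem_horDist p w')
  have hXw : push E E' Φ p (X p) = w := by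
    rw [hXp, hΦ.push_pushAdj, tangentPart_of_mem hw]
  have hYw : push E E' Φ p (Y p) = w' := by
    rw [hYp, hΦ.push_pushAdj, tangentPart_of_mem hw']
  have h := hS X Y hX hY p
  have hW := hΦ.smooth_push (hY.smoothAlongAt p)
  rw [slantIdentity_lhs hΦ hJ hθ (hY.smoothAlongAt p),
    hC.tangentPart_covAlong hΦ hf (smooth_opDelta hΦ hJ (smooth_opAlpha hΦ hJ hW))
      fun p' => normalPart_mem p' _,
    hC.tangentPart_covAlong hΦ hf (smooth_opDelta hΦ hJ hW) fun p' => normalPart_mem p' _] at h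
  -- Pairing with u kills the first term, a multiple of Φ_*X; only J of a multiple of w, and S,
  -- remain.
  have h1 := congrArg (fun v => inner ℝ v u) h
  simp only [inner_sub_left, inner_add_left, real_inner_smul_left, map_smul, inner_zero_left,
    hC.inner_sff hΦ hf hu, inner_push_normal hu] at h1
  rw [hXw, hYw] at h1
  have h2 : inner ℝ (opDelta E Φ J p w) u = inner ℝ (J (Φ p) w) u := inner_normalPart hu
  rw [h2]
  linarith

/-- For a Clairaut map onto a `J`-invariant distribution the differential of the potential
vanishes on the normal space. -/
theorem IsClairaut.mvfderiv_eq_zero_of_invariant (hΦ : IsRiemannianMap E E' Φ) (hJ : IsKahler J)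
    (hf : ContMDiff 𝓘(ℝ, E') 𝓘(ℝ, ℝ) ∞ f)
    (hC : IsClairaut E E' Φ (fun q => Real.exp (f q)))
    (hinv : ∀ p, ∀ w ∈ rangeDist E E' Φ p, J (Φ p) w ∈ rangeDist E E' Φ p)
    {w u : TangentSpace 𝓘(ℝ, E') (Φ p)} (hw : w ∈ rangeDist E E' Φ p) (hw0 : w ≠ 0)
    (hu : u ∈ (rangeDist E E' Φ p)ᗮ) : mvfderiv 𝓘(ℝ, E') f (Φ p) u = 0 := by
  have hJn : ∀ u ∈ (rangeDist E E' Φ p)ᗮ, J (Φ p) u ∈ (rangeDist E E' Φ p)ᗮ := by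
    intro u hu v hv
    rw [real_inner_comm, hJ.inner_left, real_inner_comm, hu _ (hinv p v hv), neg_zero]
  obtain ⟨x, rfl⟩ := hw
  obtain ⟨X, hX, rfl⟩ := exists_smooth_extension_vector p x
  have hW := hΦ.smooth_push (hX.smoothAlongAt (x := p) Filter.univ_mem)
  have hWt : ∀ p', push E E' Φ p' (X p') ∈ rangeDist E E' Φ p' :=
    fun p' => push_mem_rangeDist p' _
  -- ⟨∇_X(JW),u⟩ with W = Φ_*X is computed twice: umbilicity of JW gives a multiple of ⟨W,JW⟩ = 0,
  -- while ∇J = 0 and umbilicity of W give df(Ju)|W|².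
  have key : ∀ u ∈ (rangeDist E E' Φ p)ᗮ, mvfderiv 𝓘(ℝ, E') f (Φ p) (J (Φ p) u) = 0 := by
    intro u hu
    have h1 := hC.inner_covAlong hΦ hf (hJ.smoothAlongAt hW) (fun p' => hinv p' _ (hWt p')) hu
      (X p)
    rw [hJ.covAlong hW, hJ.inner_left, hC.inner_covAlong hΦ hf hW hWt (hJn u hu), neg_neg,
      real_inner_comm, real_inner_comm (J (Φ p) _), hJ.inner_self, mul_zero, neg_zero] at h1
    exact (mul_eq_zero.1 h1).resolve_right (inner_self_ne_zero.2 hw0)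
  have h2 := key _ (hJn u hu)
  rwa [hJ.sq, map_neg, neg_eq_zero] at h2

/-- The only place where the rank condition does its work, and only when sin θ ≠ 0: a vector v
orthogonal to w separates the two terms of the normal component. -/
theorem mvfderiv_eq_zero_of_slantIdentity (hΦ : IsRiemannianMap E E' Φ) (hJ : IsKahler J)
    (hθ : IsSlant E Φ J θ) (hf : ContMDiff 𝓘(ℝ, E') 𝓘(ℝ, ℝ) ∞ f)
    (hC : IsClairaut E E' Φ (fun q => Real.exp (f q))) (hS : SlantIdentity E Φ J θ)
    (hrank : Module.finrank ℝ (rangeDist E E' Φ p) ≠ 1)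
    {w u : TangentSpace 𝓘(ℝ, E') (Φ p)} (hw : w ∈ rangeDist E E' Φ p) (hw0 : w ≠ 0)
    (hu : u ∈ (rangeDist E E' Φ p)ᗮ) : mvfderiv 𝓘(ℝ, E') f (Φ p) u = 0 := by
  by_cases hcos : 1 - Real.cos θ ^ 2 = 0
  · refine hC.mvfderiv_eq_zero_of_invariant hΦ hJ hf (fun p w hw => ?_) hw hw0 hu
    have h1 := inner_opDelta_self hΦ hJ hθ hw
    rw [hcos, zero_mul, inner_self_eq_zero] at h1
    rw [← opAlpha_add_opDelta (E := E), h1, add_zero]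
    exact tangentPart_mem p _
  · obtain ⟨v, hv, hv0, hvw⟩ := exists_inner_eq_zero_of_finrank_ne_one hrank hw hw0
    -- With u = δv the first term vanishes because v ⊥ w, and |δv|² = sin²θ|v|² ≠ 0 leaves df(δw) =
    -- 0.
    have h1 := hS.inner_normal hΦ hJ hθ hf hC hv hw (normalPart_mem p (J (Φ p) v))
    change _ + _ * inner ℝ (opDelta E Φ J p v) (opDelta E Φ J p v) = 0 at h1
    rw [hvw, mul_zero, mul_zero, zero_add, inner_opDelta_self hΦ hJ hθ hv] at h1
    have h2 := (mul_eq_zero.1 h1).resolve_right (mul_ne_zero hcos (inner_self_ne_zero.2 hv0))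
    have h3 := hS.inner_normal hΦ hJ hθ hf hC hw hw hu
    rw [h2, zero_mul, add_zero, ← neg_sub, neg_mul, neg_eq_zero] at h3
    exact (mul_eq_zero.1 ((mul_eq_zero.1 h3).resolve_left hcos)).resolve_right
      (inner_self_ne_zero.2 hw0)

/-- A Riemannian map whose vertical and horizontal distributions are totally geodesic is totally
geodesic as soon as its second fundamental form vanishes on horizontal vectors. -/
theorem IsRiemannianMap.sff_eq_zero (hΦ : IsRiemannianMap E E' Φ)
    (hk : IsTotallyGeodesicDistribution (kerDist E E' Φ))
    (hh : IsTotallyGeodesicDistribution (horDist E E' Φ))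
    (hhh : ∀ x ∈ horDist E E' Φ p, ∀ y ∈ horDist E E' Φ p, sff (E' := E') Φ p x y = 0)
    (x y : TangentSpace 𝓘(ℝ, E) p) : sff (E' := E') Φ p x y = 0 := by
  have hkk : ∀ x ∈ kerDist E E' Φ p, ∀ y ∈ kerDist E E' Φ p, sff (E' := E') Φ p x y = 0 := by
    intro x hx y hy
    obtain ⟨X, hX, rfl⟩ := hΦ.exists_section_kerDist hx
    obtain ⟨Y, hY, rfl⟩ := hΦ.exists_section_kerDist hy
    rw [hΦ.sff_section_kerDist hY, mem_kerDist.1 (hk X Y hX hY p), neg_zero]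
  have hhk : ∀ x ∈ horDist E E' Φ p, ∀ y ∈ kerDist E E' Φ p, sff (E' := E') Φ p x y = 0 := by
    intro x hx y hy
    obtain ⟨X, hX, rfl⟩ := hΦ.exists_section_horDist hx
    obtain ⟨Y, hY, rfl⟩ := hΦ.exists_section_kerDist hy
    rw [hΦ.sff_section_kerDist hY, neg_eq_zero, ← mem_kerDist]
    -- ∇_XY is vertical since ⟨∇_XY,Z⟩ = -⟨Y,∇_XZ⟩, and ∇_XZ is horizontal by `hh`.
    refine mem_kerDist_of_inner fun z hz => ?_
    obtain ⟨Z, hZ, rfl⟩ := hΦ.exists_section_horDist hz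
    have h1 := mvfderiv_inner (hY.smoothAlongAt p) (hZ.smoothAlongAt p) (X p)
    have heq : (fun p' => inner ℝ (Y p') (Z p')) = fun _ => (0 : ℝ) :=
      funext fun p' => hZ.2 p' _ (hY.2 p')
    have h2 : inner ℝ (Y p) (covAlong (fun y : P => y) Z p (X p)) = 0 :=
      hh X Z hX hZ p _ (hY.2 p)
    rw [heq, mvfderiv_const, h2, add_zero] at h1
    exact h1.symm
  have hdec : ∀ x : TangentSpace 𝓘(ℝ, E) p, ∃ a ∈ horDist E E' Φ p, ∃ b ∈ kerDist E E' Φ p,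
      x = a + b := fun x => ⟨_, pushAdj_mem_horDist p (push E E' Φ p x), _,
    hΦ.sub_pushAdj_mem_kerDist p x, (add_sub_cancel _ _).symm⟩
  obtain ⟨a, ha, b, hb, rfl⟩ := hdec x
  obtain ⟨c, hc, d, hd, rfl⟩ := hdec y
  rw [sff_add_left, sff_add_right, sff_add_right, hhh a ha c hc, hhk a ha d hd,
    sff_symm hΦ.1 p b c, hhk c hc b hb, hkk b hb d hd]
  simp

theorem sff_horDist_eq_zero (hΦ : IsRiemannianMap E E' Φ) (hJ : IsKahler J)
    (hθ : IsSlant E Φ J θ) (hf : ContMDiff 𝓘(ℝ, E') 𝓘(ℝ, ℝ) ∞ f)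
    (hC : IsClairaut E E' Φ (fun q => Real.exp (f q))) (hS : SlantIdentity E Φ J θ)
    (hrank : Module.finrank ℝ (rangeDist E E' Φ p) ≠ 1)
    {x y : TangentSpace 𝓘(ℝ, E) p} (hx : x ∈ horDist E E' Φ p) (hy : y ∈ horDist E E' Φ p) :
    sff (E' := E') Φ p x y = 0 := by
  have hn : ∀ u ∈ (rangeDist E E' Φ p)ᗮ, inner ℝ (sff Φ p x y) u = 0 := by
    intro u hu
    rw [hC.inner_sff hΦ hf hu]
    -- A nonzero vector of the range is needed to conclude that df vanishes on normal vectors; this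
    -- case also covers rank 0.
    by_cases hx0 : push E E' Φ p x = 0
    · rw [hx0, inner_zero_left, mul_zero, neg_zero]
    · rw [mvfderiv_eq_zero_of_slantIdentity hΦ hJ hθ hf hC hS hrank (push_mem_rangeDist p x) hx0
        hu, zero_mul, neg_zero]
  have hnorm : sff Φ p x y ∈ (rangeDist E E' Φ p)ᗮ := by
    rintro _ ⟨z, rfl⟩
    rw [real_inner_comm]
    exact hΦ.inner_sff_push hx hy z
  exact inner_self_eq_zero.1 (hn _ hnorm)

end TotallyGeodesic

end SlantMaps

end

open SlantMaps in
theorem mainTheorem2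
    {E : Type*} [NormedAddCommGroup E] [NormedSpace ℝ E] [FiniteDimensional ℝ E]
    {P : Type*} [TopologicalSpace P] [T2Space P] [ChartedSpace E P] [IsManifold 𝓘(ℝ, E) ∞ P]
    [RiemannianBundle (fun x : P => TangentSpace 𝓘(ℝ, E) x)]
    [IsContMDiffRiemannianBundle 𝓘(ℝ, E) ∞ E (fun x : P => TangentSpace 𝓘(ℝ, E) x)]
    {E' : Type*} [NormedAddCommGroup E'] [NormedSpace ℝ E'] [FiniteDimensional ℝ E']
    {Q : Type*} [TopologicalSpace Q] [T2Space Q] [ChartedSpace E' Q] [IsManifold 𝓘(ℝ, E') ∞ Q]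
    [RiemannianBundle (fun x : Q => TangentSpace 𝓘(ℝ, E') x)]
    [IsContMDiffRiemannianBundle 𝓘(ℝ, E') ∞ E' (fun x : Q => TangentSpace 𝓘(ℝ, E') x)]
    (J : ∀ q : Q, TangentSpace 𝓘(ℝ, E') q →L[ℝ] TangentSpace 𝓘(ℝ, E') q) (hJ : IsKahler J)
    (Φ : P → Q) (hΦ : IsRiemannianMap E E' Φ)
    (θ : ℝ) (hθ : IsSlant E Φ J θ)
    (f : Q → ℝ) (hf : ContMDiff 𝓘(ℝ, E') 𝓘(ℝ, ℝ) ∞ f)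
    (hClairaut : IsClairaut E E' Φ (fun q => Real.exp (f q))) :
    (IsTotallyGeodesicMap E E' Φ →
      IsTotallyGeodesicDistribution (kerDist E E' Φ) ∧
      IsTotallyGeodesicDistribution (horDist E E' Φ) ∧
      SlantIdentity E Φ J θ) ∧
    ((∀ p, Module.finrank ℝ (rangeDist E E' Φ p) ≠ 1) →
      IsTotallyGeodesicDistribution (kerDist E E' Φ) ∧
      IsTotallyGeodesicDistribution (horDist E E' Φ) ∧
      SlantIdentity E Φ J θ →
      IsTotallyGeodesicMap E E' Φ) := by
  constructor
  · intro h
    rw [isTotallyGeodesicMap_iff hΦ.1] at h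
    exact ⟨hΦ.isTotallyGeodesicDistribution_kerDist h,
      hΦ.isTotallyGeodesicDistribution_horDist h, slantIdentity_of_sff_eq_zero hΦ hJ hθ h⟩
  · rintro hrank ⟨hk, hh, hS⟩
    rw [isTotallyGeodesicMap_iff hΦ.1]
    exact fun p => hΦ.sff_eq_zero hk hh fun x hx y hy =>
      sff_horDist_eq_zero hΦ hJ hθ hf hClairaut hS (hrank p) hx hy
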